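/- Let $H$ be a separable complex Hilbert space, let $A$ be a non-negative self-adjoint (in general unbounded) operator in $H$, and put $\Lambda=\sqrt A$. Let $E$ be the abstract energy space, i.e. the completion of $(\mathcal D(\Lambda)\ominus\operatorname{Ker}\Lambda)\times H$ in the norm $\|(u_1,u_2)\|_E=\|(\Lambda u_1,u_2)\|_{H\times H}$ (equivalently, the Hausdorff completion of $\mathcal D(\Lambda)\times H$ for this seminorm). Let $b\ge 0$ on $[0,\infty)$ and $b\in L^1[0,\infty)$. Then the Cauchy problems for the damped equation $u''+2b(t)u'+Au=0$ and for the free equation $v''+Av=0$ are well-posed on $[0,\infty)$: Cauchy data in $\mathcal D(\Lambda)\times H$ have a unique weak solution in $C([0,\infty);\mathcal D(\Lambda))\cap C^1([0,\infty);H)$ (the equation being understood in the form integrated in time and tested with elements of $\mathcal D(A)$), and data in $E$ have a unique $E$-valued solution $t\mapsto(u(t),u'(t))$, a solution with data in $E$ being a locally uniform limit in $E$ of solutions with data in $\mathcal D(\Lambda)\times H$. Moreover, there are a bounded linear operator $W_+$ on $E$ with bounded inverse and a constant $C$ such that for every $(u_1,u_2)\in E$ and $(v_1,v_2)=W_+(u_1,u_2)$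 the solution $u$ of the damped equation with data $(u_1,u_2)$ at $t=0$ and the solution $v$ of the free equation with data $(v_1,v_2)$ at $t=0$ satisfy $$\|(u(t),u'(t))-(v(t),v'(t))\|_E\le C\,\|(u_1,u_2)\|_E\int_t^\infty b(\tau)\,\mathrm d\tau\quad\text{for all }t\ge 0,$$ where the right-hand side, and hence the left-hand side, tends to $0$ as $t\to\infty$. In particular, if $(u_1,u_2)\ne 0$ in $E$, then $\|(u(t),u'(t))\|_E$ converges to a positive limit as $t\to\infty$, so the energy of $u$ does not decay to zero. -/

import Mathlib

open scoped InnerProductSpace Topology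
open Set Filter MeasureTheory

namespace DampedWave

variable {H : Type*} [NormedAddCommGroup H] [InnerProductSpace ℂ H] [CompleteSpace H]

/-- A (possibly unbounded) operator `T` is non-negative: `⟨T x, x⟩ ≥ 0` on its domain. -/
def IsNonneg (T : H →ₗ.[ℂ] H) : Prop :=
  ∀ x : T.domain, 0 ≤ (⟪T x, (x : H)⟫_ℂ).re

/-- `L` is a non-negative self-adjoint square root of `A`: `L` is self-adjoint and non-negative,
and `A = L ∘ L` with its natural domain `{x ∈ D(L) | L x ∈ D(L)}` (an equality of graphs). -/
structure IsNonnegSqrt (A L : H →ₗ.[ℂ] H) : Prop where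
  selfAdjoint : IsSelfAdjoint L
  nonneg : IsNonneg L
  sq : ∀ x y : H, (x, y) ∈ A.graph ↔ ∃ z : H, (x, z) ∈ L.graph ∧ (z, y) ∈ L.graph

/-- `Λ = √A`, the non-negative self-adjoint square root of the operator `A`
(every non-negative self-adjoint `A` has exactly one). -/
noncomputable def sqrtOp (A : H →ₗ.[ℂ] H) : H →ₗ.[ℂ] H :=
  Classical.epsilon (IsNonnegSqrt A)

/-- The space `D(Λ) × H` of Cauchy data, `Λ = √A`. It carries the energy seminorm below. -/
def Data (A : H →ₗ.[ℂ] H) : Type _ := (sqrtOp A).domain × H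

noncomputable instance (A : H →ₗ.[ℂ] H) : AddCommGroup (Data A) :=
  inferInstanceAs (AddCommGroup ((sqrtOp A).domain × H))

noncomputable instance (A : H →ₗ.[ℂ] H) : Module ℂ (Data A) :=
  inferInstanceAs (Module ℂ ((sqrtOp A).domain × H))

/-- The pair `(u₁, u₂)` as an element of `D(Λ) × H`. -/
def Data.mk {A : H →ₗ.[ℂ] H} (u₁ : (sqrtOp A).domain) (u₂ : H) : Data A := (u₁, u₂)

/-- The linear map `(u₁, u₂) ↦ (Λ u₁, u₂)` into the Hilbert space `H × H`. -/
noncomputable def Data.toProd (A : H →ₗ.[ℂ] H) : Data A →ₗ[ℂ] WithLp 2 (H × H) :=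
  (WithLp.linearEquiv 2 ℂ (H × H)).symm.toLinearMap ∘ₗ
    (((sqrtOp A).toFun.prodMap LinearMap.id : (sqrtOp A).domain × H →ₗ[ℂ] H × H))

/-- The energy seminorm `‖(u₁, u₂)‖_E = ‖(Λ u₁, u₂)‖_{H × H}`. -/
noncomputable instance (A : H →ₗ.[ℂ] H) : SeminormedAddCommGroup (Data A) :=
  SeminormedAddCommGroup.induced (Data A) (WithLp 2 (H × H)) (Data.toProd A)

noncomputable instance (A : H →ₗ.[ℂ] H) : NormedSpace ℂ (Data A) :=
  NormedSpace.induced ℂ (Data A) (WithLp 2 (H × H)) (Data.toProd A)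

theorem Data.norm_mk (A : H →ₗ.[ℂ] H) (x : (sqrtOp A).domain) (y : H) :
    ‖(Data.mk x y : Data A)‖ = Real.sqrt (‖sqrtOp A x‖ ^ 2 + ‖y‖ ^ 2) := by
  change ‖WithLp.toLp 2 ((sqrtOp A x, y) : H × H)‖ = _
  rw [WithLp.prod_norm_eq_of_L2]
  rfl

/-- The abstract energy space `E`: the (Hausdorff) completion of `D(Λ) × H` for the energy
seminorm. The completion identifies data at energy distance zero, i.e. data which differ by an
element of `Ker Λ × {0}`; since `D(Λ) = Ker Λ ⊕ (D(Λ) ⊖ Ker Λ)`, this is the completion of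
`(D(Λ) ⊖ Ker Λ) × H` for the energy norm. -/
abbrev EnergySpace (A : H →ₗ.[ℂ] H) : Type _ := UniformSpace.Completion (Data A)

/-- The element of `E` given by `(u₁, u₂) ∈ D(Λ) × H`. -/
noncomputable def toEnergy (A : H →ₗ.[ℂ] H) (x : (sqrtOp A).domain) (y : H) : EnergySpace A :=
  ((Data.mk x y : Data A) : UniformSpace.Completion (Data A))

/-- `u`, with derivative `u'`, is a finite-energy (weak) solution on `[0, ∞)` of
`u'' + 2 b(t) u' + A u = 0`: `u ∈ C([0, ∞); D(Λ)) ∩ C¹([0, ∞); H)`, and the equation, integrated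
from `0` to `t`, holds when tested with the elements of `D(A)` (`A` being self-adjoint).
The Cauchy data are `(u 0, u' 0) ∈ D(Λ) × H`. -/
structure IsFiniteEnergySolution (A : H →ₗ.[ℂ] H) (b : ℝ → ℝ)
    (u : ℝ → (sqrtOp A).domain) (u' : ℝ → H) : Prop where
  continuousOn_sqrt : ContinuousOn (fun t => sqrtOp A (u t)) (Ici 0)
  hasDeriv : ∀ t ∈ Ici (0 : ℝ), HasDerivWithinAt (fun s => (u s : H)) (u' t) (Ici 0) t
  continuousOn_deriv : ContinuousOn u' (Ici 0)
  equation : ∀ φ : A.domain, ∀ t ∈ Ici (0 : ℝ),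
    ⟪(φ : H), u' t⟫_ℂ - ⟪(φ : H), u' 0⟫_ℂ
      + (∫ s in (0 : ℝ)..t, (((2 * b s : ℝ) : ℂ) * ⟪(φ : H), u' s⟫_ℂ + ⟪A φ, (u s : H)⟫_ℂ)) = 0

/-- `U : [0, ∞) → E` is the solution `t ↦ (u(t), u'(t))` of `u'' + 2 b(t) u' + A u = 0` with Cauchy
data `x ∈ E`: a locally uniform limit in `E` of finite-energy solutions (with Cauchy data in
`D(Λ) × H`) which starts at `x`. -/
def IsEnergySolution (A : H →ₗ.[ℂ] H) (b : ℝ → ℝ) (x : EnergySpace A)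
    (U : ℝ → EnergySpace A) : Prop :=
  U 0 = x ∧ ∃ (u : ℕ → ℝ → (sqrtOp A).domain) (u' : ℕ → ℝ → H),
    (∀ n, IsFiniteEnergySolution A b (u n) (u' n)) ∧
    ∀ T : ℝ, TendstoUniformlyOn (fun n t => toEnergy A (u n t) (u' n t)) U atTop (Icc 0 T)

/-- The Cauchy problem for `u'' + 2 b(t) u' + A u = 0` is well-posed: data in `D(Λ) × H` have a
unique finite-energy solution, and data in the energy space have a unique solution in `E`. -/
structure WellPosed (A : H →ₗ.[ℂ] H) (b : ℝ → ℝ) : Prop where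
  exists_finite : ∀ (u₁ : (sqrtOp A).domain) (u₂ : H), ∃ u u',
    IsFiniteEnergySolution A b u u' ∧ u 0 = u₁ ∧ u' 0 = u₂
  unique_finite : ∀ u u' v v', IsFiniteEnergySolution A b u u' → IsFiniteEnergySolution A b v v' →
    u 0 = v 0 → u' 0 = v' 0 → EqOn u v (Ici 0) ∧ EqOn u' v' (Ici 0)
  exists_energy : ∀ x : EnergySpace A, ∃ U, IsEnergySolution A b x U
  unique_energy : ∀ (x : EnergySpace A) (U V : ℝ → EnergySpace A),
    IsEnergySolution A b x U → IsEnergySolution A b x V → EqOn U V (Ici 0)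

end DampedWave

/-! Write a solution as the vector `(Λu, u')` in `H × H`. The equation becomes `U' = GU - 2b(t)PU`,
where `G(p, q) = (Λq, -Λp)` is formally skew-adjoint and `P(p, q) = (0, q)`. Let `S` be the
isometric group of `G` and put `Z(t) = S(-t)U(t)`. Free solutions have constant `Z`, while damped
ones satisfy `Z(t) = x - ∫₀ᵗ 2b(s) S(-s)PS(s) Z(s) ds`, whose kernel is bounded in norm by the
integrable function `2b`. So `Z(t)` converges to some `Wx`, with an error controlled by the tail
`∫ₜ^∞ b`. Conversely, a prescribed limit `y` determines `Z` through the backward equation `Z(t) = y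
+ ∫ₜ^∞ 2b S(-s)PS(s)Z ds`, so `W` is invertible. Both integral equations are solved on bounded
continuous functions, where an exponential weight makes the integral operator a contraction
(`isUnit_one_add_volterra`, `isUnit_one_add_volterra_sub_total`). Since `S` is isometric, the energy
norm of `U(t)` tends to `‖Wx‖`, which is positive for `x ≠ 0`.

It remains to match this picture with the weak solutions of the statement. The continuous functional
calculus of the bounded operator `(1 + A)⁻¹` yields a square root of `A` and cutoffs `cut n → 1` for
which `Λ ∘ cut n` is bounded (`IsNonnegSqrt.nonempty_spectralCutoff`). The group `S` is the strong
limit of the exponentials of the cut-off generators, which stabilise on the range of each cutoff. A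
cutoff turns the weak equation into a linear equation with bounded generator; variation of constants
then shows that weak and mild solutions coincide (`IsWeak.isMild`, `isWeak_of_isMild`). As `b` is
merely integrable, this rests on calculus for absolutely continuous functions. Finally `E` embeds
isometrically into `H × H` with image invariant under `S` and `P` (`exists_energyFlow`), so
everything restricts to `E`. -/

namespace DampedWave

/-! ### Calculus for absolutely continuous vector-valued functions. -/

section AbsolutelyContinuous

theorem absolutelyContinuousOnInterval_of_dist_le {X Y Z : Type*} [PseudoMetricSpace X]
    [PseudoMetricSpace Y] [PseudoMetricSpace Z] {f : ℝ → X} {g : ℝ → Y} {h : ℝ → Z} {a b C : ℝ}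
    (hf : AbsolutelyContinuousOnInterval f a b) (hg : AbsolutelyContinuousOnInterval g a b)
    (hle : ∀ s ∈ uIcc a b, ∀ t ∈ uIcc a b,
      dist (h s) (h t) ≤ C * (dist (f s) (f t) + dist (g s) (g t))) :
    AbsolutelyContinuousOnInterval h a b := by
  unfold AbsolutelyContinuousOnInterval at *
  have hlim := (hf.add hg).const_mul C
  rw [add_zero, mul_zero] at hlim
  refine squeeze_zero' (Eventually.of_forall fun _ => Finset.sum_nonneg fun _ _ => dist_nonneg)
    ?_ hlim
  rw [eventually_inf_principal]
  filter_upwards with p hp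
  rw [← Finset.sum_add_distrib, Finset.mul_sum]
  exact Finset.sum_le_sum fun i hi => hle _ (hp.1 i hi).1 _ (hp.1 i hi).2

theorem absolutelyContinuousOnInterval_const {X : Type*} [PseudoMetricSpace X] (x : X) (a b : ℝ) :
    AbsolutelyContinuousOnInterval (fun _ => x) a b := by
  simpa [AbsolutelyContinuousOnInterval] using tendsto_const_nhds

variable {X : Type*} [NormedAddCommGroup X] [NormedSpace ℝ X]

/-- Increments are dominated by those of the scalar primitive of `‖f‖`, which is absolutely
continuous. -/
theorem absolutelyContinuousOnInterval_integral {f : ℝ → X} {a b : ℝ}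
    (hf : IntervalIntegrable f volume a b) :
    AbsolutelyContinuousOnInterval (fun t => ∫ s in a..t, f s) a b := by
  refine absolutelyContinuousOnInterval_of_dist_le (C := 1)
    (hf.norm.absolutelyContinuousOnInterval_intervalIntegral (c := a) left_mem_uIcc)
    (absolutelyContinuousOnInterval_const (0 : ℝ) a b) fun s hs t ht => ?_
  have h1 : IntervalIntegrable f volume a s :=
    hf.mono_set (uIcc_subset_uIcc_left hs)
  have h2 : IntervalIntegrable f volume a t :=
    hf.mono_set (uIcc_subset_uIcc_left ht)
  rw [dist_eq_norm, dist_eq_norm, intervalIntegral.integral_interval_sub_left h1 h2,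
    intervalIntegral.integral_interval_sub_left h1.norm h2.norm]
  simpa using intervalIntegral.norm_integral_le_abs_integral_norm

/-- Subtracting the primitive of `h'` leaves an absolutely continuous function whose derivative
vanishes almost everywhere, hence a constant. -/
theorem integral_eq_sub_of_absolutelyContinuous [CompleteSpace X] {h h' : ℝ → X} {a b : ℝ}
    (hac : AbsolutelyContinuousOnInterval h a b) (hint : IntervalIntegrable h' volume a b)
    (hd : ∀ᵐ x, x ∈ uIcc a b → HasDerivAt h (h' x) x) :
    ∫ x in a..b, h' x = h b - h a := by
  have hac' := hac.sub (absolutelyContinuousOnInterval_integral hint)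
  obtain ⟨C, hC⟩ := hac'.const_of_ae_hasDerivAt_zero (by
    filter_upwards [hd, hint.ae_hasDerivAt_integral] with x h1 h2 h3
    simpa using (h1 h3).sub (h2 h3 a left_mem_uIcc))
  have h1 := hC a left_mem_uIcc
  have h2 := hC b right_mem_uIcc
  simp only [Pi.sub_apply, intervalIntegral.integral_same, sub_zero] at h1 h2
  rw [h1, ← h2]; abel

/-- The product rule, in integrated form, for a `C¹` family of operators applied to a primitive of
an integrable function. -/
theorem clm_apply_primitive [CompleteSpace X] {F F' : ℝ → X →L[ℝ] X}
    (hF : ∀ t, HasDerivAt F (F' t) t) (hF' : Continuous F') {f : ℝ → X} {T : ℝ}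
    (hf : IntervalIntegrable f volume 0 T) (z : X) :
    F T (z + ∫ s in (0 : ℝ)..T, f s) =
      F 0 z + ∫ t in (0 : ℝ)..T, (F' t (z + ∫ s in (0 : ℝ)..t, f s) + F t (f t)) := by
  set Z : ℝ → X := fun t => z + ∫ s in (0 : ℝ)..t, f s with hZ
  have hFc : Continuous F := continuous_iff_continuousAt.2 fun t => (hF t).continuousAt
  have hZac : AbsolutelyContinuousOnInterval Z 0 T := by
    refine absolutelyContinuousOnInterval_of_dist_le (C := 1)
      (absolutelyContinuousOnInterval_integral hf)
      (absolutelyContinuousOnInterval_const (0 : ℝ) 0 T) fun s _ t _ => ?_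
    simp [hZ]
  have hFac : AbsolutelyContinuousOnInterval F 0 T :=
    ContDiffOn.absolutelyContinuousOnInterval
      (contDiff_one_iff_deriv.2 ⟨fun t => (hF t).differentiableAt, by
        rwa [show deriv F = F' from funext fun t => (hF t).deriv]⟩).contDiffOn
  have hZc : ContinuousOn Z (uIcc 0 T) := hZac.continuousOn
  obtain ⟨C, hC⟩ := hZac.exists_bound
  obtain ⟨D, hD⟩ := hFac.exists_bound
  have hac : AbsolutelyContinuousOnInterval (fun t => F t (Z t)) 0 T := by
    refine absolutelyContinuousOnInterval_of_dist_le (C := max C D) hFac hZac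
      fun s hs t ht => ?_
    rw [dist_eq_norm, dist_eq_norm, dist_eq_norm]
    have : F s (Z s) - F t (Z t) = (F s - F t) (Z s) + F t (Z s - Z t) := by simp
    rw [this, mul_add, mul_comm (max C D)]
    refine (norm_add_le _ _).trans (add_le_add ?_ ?_)
    · refine ((F s - F t).le_opNorm _).trans ?_
      gcongr
      exact (hC s hs).trans (le_max_left _ _)
    · refine ((F t).le_opNorm _).trans ?_
      gcongr
      exact (hD t ht).trans (le_max_right _ _)
  have hint : IntervalIntegrable (fun t => F' t (Z t) + F t (f t)) volume 0 T := by
    refine IntervalIntegrable.add (ContinuousOn.intervalIntegrable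
      (hF'.continuousOn.clm_apply hZc)) ?_
    rw [intervalIntegrable_iff] at hf ⊢
    refine Integrable.mono' (hf.norm.const_mul D) ?_ ?_
    · exact (isBoundedBilinearMap_apply.continuous.comp_aestronglyMeasurable
        (hFc.aestronglyMeasurable.prodMk hf.aestronglyMeasurable))
    · refine (ae_restrict_iff' measurableSet_uIoc).2 (Eventually.of_forall fun t ht => ?_)
      exact ((F t).le_opNorm _).trans (by gcongr; exact hD t (uIoc_subset_uIcc ht))
  have key := integral_eq_sub_of_absolutelyContinuous hac hint (by
    filter_upwards [hf.ae_hasDerivAt_integral] with t ht1 ht2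
    exact (hF t).clm_apply ((ht1 ht2 0 left_mem_uIcc).const_add z))
  have h0 : Z 0 = z := by simp [hZ]
  rw [key, h0]
  change F T (Z T) = _
  abel

theorem integral_mul_exp_primitive {β : ℝ → ℝ} (hβ : Integrable β) (k a b : ℝ) :
    ∫ t in a..b, k * β t * Real.exp (k * ∫ s in Iic t, β s) =
      Real.exp (k * ∫ s in Iic b, β s) - Real.exp (k * ∫ s in Iic a, β s) := by
  have hB : ∀ t, ∫ s in Iic t, β s = (∫ s in Iic a, β s) + ∫ s in a..t, β s := fun t => by
    rw [← intervalIntegral.integral_Iic_sub_Iic hβ.integrableOn hβ.integrableOn]; ring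
  have hi : IntervalIntegrable β volume a b := hβ.intervalIntegrable
  have hBac : AbsolutelyContinuousOnInterval (fun t => k * ∫ s in Iic t, β s) a b := by
    refine AbsolutelyContinuousOnInterval.const_mul k ?_
    refine absolutelyContinuousOnInterval_of_dist_le (C := 1)
      (absolutelyContinuousOnInterval_integral hi)
      (absolutelyContinuousOnInterval_const (0 : ℝ) a b) fun s _ t _ => ?_
    rw [hB s, hB t]; simp
  obtain ⟨C, hC⟩ := hBac.exists_bound
  -- The exponent stays in a compact interval, where `exp` is Lipschitz; composing with it therefore
  -- preserves absolute continuity.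
  have hexp : LipschitzOnWith (Real.toNNReal (Real.exp C)) Real.exp (Icc (-C) C) := by
    refine (convex_Icc (-C) C).lipschitzOnWith_of_nnnorm_deriv_le
      (fun x _ => Real.differentiableAt_exp) fun x hx => ?_
    rw [Real.deriv_exp, ← NNReal.coe_le_coe, coe_nnnorm, Real.norm_eq_abs, Real.abs_exp,
      Real.coe_toNNReal _ (Real.exp_pos C).le]
    exact Real.exp_le_exp.2 hx.2
  have hmem : ∀ s ∈ uIcc a b, (k * ∫ r in Iic s, β r) ∈ Icc (-C) C := fun s hs =>
    abs_le.1 (hC s hs)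
  have hac : AbsolutelyContinuousOnInterval (fun t => Real.exp (k * ∫ s in Iic t, β s)) a b := by
    refine absolutelyContinuousOnInterval_of_dist_le (C := Real.toNNReal (Real.exp C)) hBac
      (absolutelyContinuousOnInterval_const (0 : ℝ) a b) fun s hs t ht => ?_
    simpa using hexp.dist_le_mul _ (hmem s hs) _ (hmem t ht)
  refine integral_eq_sub_of_absolutelyContinuous hac ?_ ?_
  · exact (hi.const_mul k).mul_continuousOn hac.continuousOn
  · filter_upwards [hi.ae_hasDerivAt_integral] with t ht1 ht2
    have h1 := ((ht1 ht2 a left_mem_uIcc).const_add (∫ s in Iic a, β s)).const_mul k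
    have h2 := h1.exp
    simp_rw [← hB] at h2
    exact h2.congr_deriv (by ring)

end AbsolutelyContinuous

/-! ### Volterra equations with integrable kernel, and the abstract wave operator. -/

section Volterra
open scoped BoundedContinuousFunction

variable {X : Type*} [NormedAddCommGroup X] [NormedSpace ℂ X]

/-- The operators converge only strongly, so the argument is frozen at its limit and the uniform
norm bound absorbs the error. -/
theorem tendsto_clm_apply_of_norm_le {α : Type*} {l : Filter α} {N : α → X →L[ℂ] X} {c : ℝ}
    (hN : ∀ a, ‖N a‖ ≤ c) {Z : α → X} {z y : X} (hZ : Tendsto Z l (𝓝 z))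
    (hNz : Tendsto (fun a => N a z) l (𝓝 y)) : Tendsto (fun a => N a (Z a)) l (𝓝 y) := by
  have h : Tendsto (fun a => N a (Z a - z)) l (𝓝 0) := by
    refine squeeze_zero_norm (fun a => (N a).le_of_opNorm_le (hN a) _) ?_
    simpa using ((hZ.sub_const z).norm).const_mul c
  simpa using h.add hNz

/-- The data `β(s) N(s)` of the integral equation `Z(t) = x - ∫_{-∞}^t β(s) N(s) Z(s) ds`. -/
structure IntegralKernel (X : Type*) [NormedAddCommGroup X] [NormedSpace ℂ X] where
  weight : ℝ → ℝ
  op : ℝ → X →L[ℂ] X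
  integrable_weight : Integrable weight
  weight_nonneg : ∀ s, 0 ≤ weight s
  norm_op_le : ∀ s, ‖op s‖ ≤ 2
  continuous_op : ∀ x, Continuous fun s => op s x

namespace IntegralKernel

variable (k : IntegralKernel X)

theorem continuous_op_apply {Z : ℝ → X} (hZ : Continuous Z) :
    Continuous fun s => k.op s (Z s) :=
  continuous_iff_continuousAt.2 fun s =>
    tendsto_clm_apply_of_norm_le k.norm_op_le (hZ.tendsto s) ((k.continuous_op (Z s)).tendsto s)

theorem norm_integrand_le {Z : ℝ → X} {D : ℝ → ℝ} (hD : ∀ s, ‖Z s‖ ≤ D s) (s : ℝ) :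
    ‖(k.weight s : ℂ) • k.op s (Z s)‖ ≤ k.weight s * (2 * D s) := by
  rw [norm_smul, Complex.norm_real, Real.norm_of_nonneg (k.weight_nonneg s)]
  have h0 := k.weight_nonneg s
  gcongr
  refine ((k.op s).le_of_opNorm_le (k.norm_op_le s) _).trans ?_
  gcongr
  exact hD s

theorem integrable_integrand (Z : ℝ →ᵇ X) :
    Integrable fun s => (k.weight s : ℂ) • k.op s (Z s) := by
  refine (k.integrable_weight.mul_const (2 * ‖Z‖)).mono' ?_
    (Eventually.of_forall (k.norm_integrand_le fun s => Z.norm_coe_le_norm s))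
  exact (Complex.continuous_ofReal.comp_aestronglyMeasurable
    k.integrable_weight.aestronglyMeasurable).smul
    (k.continuous_op_apply Z.continuous).aestronglyMeasurable

/-- The operator `Z ↦ ∫_ℝ β N Z`. -/
noncomputable def total : (ℝ →ᵇ X) →L[ℂ] X :=
  LinearMap.mkContinuous
    { toFun := fun Z => ∫ s, (k.weight s : ℂ) • k.op s (Z s)
      map_add' := fun Z Z' => by
        rw [← integral_add (k.integrable_integrand Z) (k.integrable_integrand Z')]
        simp
      map_smul' := fun c Z => by
        rw [RingHom.id_apply, ← integral_smul]
        simp [smul_comm c] } (2 * ∫ s, k.weight s) fun Z => by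
    refine (norm_integral_le_of_norm_le (k.integrable_weight.mul_const (2 * ‖Z‖))
      (Eventually.of_forall (k.norm_integrand_le fun s => Z.norm_coe_le_norm s))).trans_eq ?_
    rw [integral_mul_const]; ring

theorem total_apply (Z : ℝ →ᵇ X) : k.total Z = ∫ s, (k.weight s : ℂ) • k.op s (Z s) := rfl

theorem norm_setIntegral_le {s : Set ℝ} {Z : ℝ →ᵇ X} {D : ℝ → ℝ}
    (hD : ∀ r, ‖Z r‖ ≤ D r) (hi : Integrable fun r => k.weight r * (2 * D r)) :
    ‖∫ r in s, (k.weight r : ℂ) • k.op r (Z r)‖ ≤ ∫ r in s, k.weight r * (2 * D r) :=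
  norm_integral_le_of_norm_le hi.integrableOn
    (Eventually.of_forall (k.norm_integrand_le hD))

theorem norm_setIntegral_Iic_le (Z : ℝ →ᵇ X) (t : ℝ) :
    ‖∫ s in Iic t, (k.weight s : ℂ) • k.op s (Z s)‖ ≤ (2 * ∫ s, k.weight s) * ‖Z‖ := by
  have hi := k.integrable_weight.mul_const (2 * ‖Z‖)
  refine (k.norm_setIntegral_le (fun s => Z.norm_coe_le_norm s) hi).trans ?_
  refine (setIntegral_le_integral hi (Eventually.of_forall fun s =>
    mul_nonneg (k.weight_nonneg s) (by positivity))).trans_eq ?_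
  rw [integral_mul_const]; ring

/-- The Volterra operator `Z ↦ (t ↦ ∫_{-∞}^t β N Z)`. -/
noncomputable def volterra : (ℝ →ᵇ X) →L[ℂ] (ℝ →ᵇ X) :=
  LinearMap.mkContinuous
    { toFun := fun Z => BoundedContinuousFunction.ofNormedAddCommGroup
        (fun t => ∫ s in Iic t, (k.weight s : ℂ) • k.op s (Z s))
        (by
          have h : ∀ t, ∫ s in Iic t, (k.weight s : ℂ) • k.op s (Z s) =
              (∫ s in Iic 0, (k.weight s : ℂ) • k.op s (Z s)) +
                ∫ s in (0 : ℝ)..t, (k.weight s : ℂ) • k.op s (Z s) := fun t => by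
            rw [← intervalIntegral.integral_Iic_sub_Iic (k.integrable_integrand Z).integrableOn
              (k.integrable_integrand Z).integrableOn]
            abel
          exact (continuous_const.add (intervalIntegral.continuous_primitive
            (fun a b => (k.integrable_integrand Z).intervalIntegrable) 0)).congr
            fun t => (h t).symm)
        ((2 * ∫ s, k.weight s) * ‖Z‖) (k.norm_setIntegral_Iic_le Z)
      map_add' := fun Z Z' => by
        ext t
        simp only [BoundedContinuousFunction.coe_ofNormedAddCommGroup,
          BoundedContinuousFunction.coe_add, Pi.add_apply, map_add, smul_add]
        exact integral_add (k.integrable_integrand Z).integrableOn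
          (k.integrable_integrand Z').integrableOn
      map_smul' := fun c Z => by
        ext t
        simp only [BoundedContinuousFunction.coe_ofNormedAddCommGroup,
          BoundedContinuousFunction.coe_smul, map_smul, RingHom.id_apply]
        rw [← integral_smul]
        simp only [smul_comm c] } (2 * ∫ s, k.weight s) fun Z =>
    (BoundedContinuousFunction.norm_le (mul_nonneg (mul_nonneg zero_le_two
      (integral_nonneg (f := k.weight) k.weight_nonneg)) (norm_nonneg _))).2
      (k.norm_setIntegral_Iic_le Z)

theorem volterra_apply (Z : ℝ →ᵇ X) (t : ℝ) :
    k.volterra Z t = ∫ s in Iic t, (k.weight s : ℂ) • k.op s (Z s) := rfl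

theorem total_sub_volterra_apply (Z : ℝ →ᵇ X) (t : ℝ) :
    k.total Z - k.volterra Z t = ∫ s in Ioi t, (k.weight s : ℂ) • k.op s (Z s) := by
  rw [total_apply, volterra_apply, sub_eq_iff_eq_add', ← compl_Iic,
    integral_add_compl measurableSet_Iic (k.integrable_integrand Z)]

end IntegralKernel

/-- `T` halves the weighted norm `sup ‖Z‖ / w`, which is equivalent to the sup norm because `m ≤ w ≤
M`. So some power of `T` has sup-norm operator norm below `1`. -/
theorem isUnit_one_sub_of_weight [CompleteSpace X] {T : (ℝ →ᵇ X) →L[ℂ] (ℝ →ᵇ X)} {w : ℝ → ℝ}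
    {m M : ℝ} (hm : 0 < m) (hmw : ∀ t, m ≤ w t) (hwM : ∀ t, w t ≤ M)
    (h : ∀ (Z : ℝ →ᵇ X) (D : ℝ), 0 ≤ D → (∀ s, ‖Z s‖ ≤ w s * D) →
      ∀ t, ‖T Z t‖ ≤ w t * (D / 2)) : IsUnit (1 - T) := by
  have hpow : ∀ (n : ℕ) (Z : ℝ →ᵇ X) (D : ℝ), 0 ≤ D → (∀ s, ‖Z s‖ ≤ w s * D) →
      ∀ t, ‖(T ^ n) Z t‖ ≤ w t * (D / 2 ^ n) := by
    intro n
    induction n with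
    | zero => intro Z D _ hZ t; simpa using hZ t
    | succ n ih =>
      intro Z D hD hZ t
      rw [pow_succ]
      refine (ih (T Z) (D / 2) (by positivity) (h Z D hD hZ) t).trans_eq ?_
      rw [pow_succ]; ring
  have hM : 0 < M := hm.trans_le ((hmw 0).trans (hwM 0))
  have hnorm : ∀ n, ‖T ^ n‖ ≤ M / m * (1 / 2) ^ n := fun n => by
    refine ContinuousLinearMap.opNorm_le_bound _ (by positivity) fun Z => ?_
    refine (BoundedContinuousFunction.norm_le (by positivity)).2 fun t => ?_
    refine (hpow n Z (‖Z‖ / m) (by positivity) (fun s => ?_) t).trans ?_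
    · refine (Z.norm_coe_le_norm s).trans ?_
      rw [mul_div_assoc', le_div_iff₀ hm, mul_comm]
      exact mul_le_mul_of_nonneg_right (hmw s) (norm_nonneg _)
    · calc w t * (‖Z‖ / m / 2 ^ n) ≤ M * (‖Z‖ / m / 2 ^ n) := by gcongr; exact hwM t
        _ = M / m * (1 / 2) ^ n * ‖Z‖ := by rw [one_div, inv_pow]; ring
  obtain ⟨n, hn⟩ : ∃ n : ℕ, ‖T ^ n‖ < 1 := by
    have hlim : Tendsto (fun n : ℕ => M / m * (1 / 2 : ℝ) ^ n) atTop (𝓝 0) := by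
      simpa using (tendsto_pow_atTop_nhds_zero_of_lt_one (by norm_num : (0 : ℝ) ≤ 1 / 2)
        (by norm_num)).const_mul (M / m)
    obtain ⟨n, hn⟩ := (hlim.eventually (gt_mem_nhds one_pos)).exists
    exact ⟨n, (hnorm n).trans_lt hn⟩
  have hu : IsUnit (1 - T ^ n) := isUnit_one_sub_of_norm_lt_one hn
  -- `1 - Tⁿ` is the product of `1 - T` with a geometric sum; the factors commute, so each of them
  -- is a unit.
  rw [← mul_neg_geom_sum] at hu
  refine ((Commute.isUnit_mul_iff ?_).1 hu).1
  exact Commute.sum_right _ _ _ fun i _ => ((Commute.one_left _).sub_left (Commute.refl T)).pow_right i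

namespace IntegralKernel

variable (k : IntegralKernel X)

theorem setIntegral_Iic_weight_mem_Icc (t : ℝ) :
    ∫ s in Iic t, k.weight s ∈ Icc 0 (∫ s, k.weight s) :=
  ⟨integral_nonneg k.weight_nonneg,
    setIntegral_le_integral k.integrable_weight (Eventually.of_forall k.weight_nonneg)⟩

theorem continuous_setIntegral_Iic_weight : Continuous fun t => ∫ s in Iic t, k.weight s := by
  have h : ∀ t, ∫ s in Iic t, k.weight s = (∫ s in Iic 0, k.weight s) +
      ∫ s in (0 : ℝ)..t, k.weight s := fun t => by
    rw [← intervalIntegral.integral_Iic_sub_Iic k.integrable_weight.integrableOn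
      k.integrable_weight.integrableOn]
    abel
  exact (continuous_const.add (intervalIntegral.continuous_primitive
    (fun a b => k.integrable_weight.intervalIntegrable) 0)).congr fun t => (h t).symm

theorem integrable_weight_mul_exp (c : ℝ) :
    Integrable fun t => k.weight t * Real.exp (c * ∫ s in Iic t, k.weight s) := by
  refine k.integrable_weight.mul_bdd (c := Real.exp (|c| * ∫ s, k.weight s))
    (Real.continuous_exp.comp
      (continuous_const.mul k.continuous_setIntegral_Iic_weight)).aestronglyMeasurable
    (Eventually.of_forall fun t => ?_)
  rw [Real.norm_eq_abs, Real.abs_exp]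
  have h := k.setIntegral_Iic_weight_mem_Icc t
  exact Real.exp_le_exp.2 (mul_le_mul (le_abs_self c) h.2 h.1 (abs_nonneg c))

/-- The constant functions, as a bounded linear operator. -/
noncomputable def constL (X : Type*) [NormedAddCommGroup X] [NormedSpace ℂ X] :
    X →L[ℂ] (ℝ →ᵇ X) :=
  LinearMap.mkContinuous
    { toFun := BoundedContinuousFunction.const ℝ
      map_add' := fun _ _ => rfl
      map_smul' := fun _ _ => rfl } 1 fun x => by
    rw [one_mul]
    exact BoundedContinuousFunction.norm_const_le x

variable [CompleteSpace X]

/-- Forward solvability. With `B(t) = ∫_{-∞}^t β`, the weight is `e^{4B}`: since `‖N‖ ≤ 2` and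
`∫_{-∞}^t β e^{4B} ≤ e^{4B(t)} / 4`, the contraction factor is `2 / 4 = 1 / 2`. -/
theorem isUnit_one_add_volterra : IsUnit (1 + k.volterra) := by
  rw [← sub_neg_eq_add]
  refine isUnit_one_sub_of_weight (w := fun t => Real.exp (4 * ∫ s in Iic t, k.weight s))
    (m := 1) (M := Real.exp (4 * ∫ s, k.weight s)) one_pos (fun t => ?_) (fun t => ?_)
    fun Z D hD hZ t => ?_
  · exact Real.one_le_exp (mul_nonneg (by norm_num) (k.setIntegral_Iic_weight_mem_Icc t).1)
  · exact Real.exp_le_exp.2 (mul_le_mul_of_nonneg_left (k.setIntegral_Iic_weight_mem_Icc t).2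
      (by norm_num))
  · have hi := k.integrable_weight_mul_exp 4
    have hle : ∫ r in Iic t, k.weight r * Real.exp (4 * ∫ s in Iic r, k.weight s) ≤
        Real.exp (4 * ∫ s in Iic t, k.weight s) / 4 := by
      refine le_of_tendsto (intervalIntegral_tendsto_integral_Iic t hi.integrableOn tendsto_id)
        (Eventually.of_forall fun a => ?_)
      have := integral_mul_exp_primitive k.integrable_weight 4 a t
      simp_rw [mul_assoc, intervalIntegral.integral_const_mul] at this
      have hpos := Real.exp_pos (4 * ∫ s in Iic a, k.weight s)
      simp only [id] at *
      linarith
    have hi' : Integrable fun r => k.weight r *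
        (2 * (Real.exp (4 * ∫ s in Iic r, k.weight s) * D)) := by
      refine (hi.mul_const (2 * D)).congr (Eventually.of_forall fun r => ?_)
      simp only; ring
    have h1 := k.norm_setIntegral_le (s := Iic t) hZ hi'
    have h2 : ∫ r in Iic t, k.weight r * (2 * (Real.exp (4 * ∫ s in Iic r, k.weight s) * D)) =
        (∫ r in Iic t, k.weight r * Real.exp (4 * ∫ s in Iic r, k.weight s)) * (2 * D) := by
      rw [← integral_mul_const]
      congr 1; ext r; ring
    rw [_root_.neg_apply, BoundedContinuousFunction.coe_neg, Pi.neg_apply, norm_neg,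
      volterra_apply]
    nlinarith [mul_le_mul_of_nonneg_right hle (by positivity : 0 ≤ 2 * D)]

/-- Solvability from data at infinity: the operator is `Z ↦ Z(t) - ∫ₜ^∞ β N Z`. The argument is that
of the forward equation with the decreasing weight `e^{-4B}`. -/
theorem isUnit_one_add_volterra_sub_total :
    IsUnit (1 + k.volterra - constL X ∘L k.total) := by
  rw [show 1 + k.volterra - constL X ∘L k.total = 1 - (constL X ∘L k.total - k.volterra) by abel]
  refine isUnit_one_sub_of_weight (w := fun t => Real.exp ((-4) * ∫ s in Iic t, k.weight s))
    (m := Real.exp ((-4) * ∫ s, k.weight s)) (M := 1) (Real.exp_pos _) (fun t => ?_) (fun t => ?_)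
    fun Z D hD hZ t => ?_
  · exact Real.exp_le_exp.2 (by linarith [(k.setIntegral_Iic_weight_mem_Icc t).2])
  · exact Real.exp_le_one_iff.2 (by linarith [(k.setIntegral_Iic_weight_mem_Icc t).1])
  · have hi := k.integrable_weight_mul_exp (-4)
    have hle : ∫ r in Ioi t, k.weight r * Real.exp ((-4) * ∫ s in Iic r, k.weight s) ≤
        Real.exp ((-4) * ∫ s in Iic t, k.weight s) / 4 := by
      refine le_of_tendsto (intervalIntegral_tendsto_integral_Ioi t hi.integrableOn tendsto_id)
        (Eventually.of_forall fun a => ?_)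
      have := integral_mul_exp_primitive k.integrable_weight (-4) t a
      simp_rw [mul_assoc, intervalIntegral.integral_const_mul] at this
      have hpos := Real.exp_pos ((-4) * ∫ s in Iic a, k.weight s)
      simp only [id] at *
      linarith
    have hi' : Integrable fun r => k.weight r *
        (2 * (Real.exp ((-4) * ∫ s in Iic r, k.weight s) * D)) := by
      refine (hi.mul_const (2 * D)).congr (Eventually.of_forall fun r => ?_)
      simp only; ring
    have h1 := k.norm_setIntegral_le (s := Ioi t) hZ hi'
    have h2 : ∫ r in Ioi t, k.weight r *
        (2 * (Real.exp ((-4) * ∫ s in Iic r, k.weight s) * D)) =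
        (∫ r in Ioi t, k.weight r * Real.exp ((-4) * ∫ s in Iic r, k.weight s)) * (2 * D) := by
      rw [← integral_mul_const]
      congr 1; ext r; ring
    have h3 : (constL X ∘L k.total - k.volterra) Z t = k.total Z - k.volterra Z t := rfl
    rw [h3, total_sub_volterra_apply]
    nlinarith [mul_le_mul_of_nonneg_right hle (by positivity : 0 ≤ 2 * D)]

/-- The solution operator `x ↦ Z` of `Z(t) = x - ∫_{-∞}^t β N Z`. -/
noncomputable def sol : X →L[ℂ] (ℝ →ᵇ X) :=
  (Ring.inverse (1 + k.volterra)) ∘L constL X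

theorem sol_add_volterra (x : X) : k.sol x + k.volterra (k.sol x) = constL X x := by
  have h := Ring.mul_inverse_cancel _ k.isUnit_one_add_volterra
  exact DFunLike.congr_fun h (constL X x)

theorem sol_apply (x : X) (t : ℝ) :
    k.sol x t = x - ∫ s in Iic t, (k.weight s : ℂ) • k.op s (k.sol x s) := by
  have h := DFunLike.congr_fun (k.sol_add_volterra x) t
  rw [← volterra_apply, eq_sub_iff_add_eq]
  exact h

theorem eq_sol {x : X} {Z : ℝ →ᵇ X}
    (hZ : ∀ t, Z t = x - ∫ s in Iic t, (k.weight s : ℂ) • k.op s (Z s)) : Z = k.sol x := by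
  have h1 : (1 + k.volterra) Z = constL X x := by
    ext t
    exact eq_sub_iff_add_eq.1 ((hZ t).trans (by rw [← volterra_apply]; rfl))
  have h := Ring.inverse_mul_cancel _ k.isUnit_one_add_volterra
  have h2 : (Ring.inverse (1 + k.volterra) * (1 + k.volterra)) Z = Z := by rw [h]; rfl
  rw [← h2]
  exact congrArg _ h1

/-- The wave operator `x ↦ x - ∫_ℝ β N Z`, the limit at `∞` of the solution `Z` with data `x`. -/
noncomputable def wave : X ≃L[ℂ] X :=
  ContinuousLinearEquiv.equivOfInverse (1 - k.total ∘L k.sol)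
    -- The inverse solves the backward equation `Z(t) = y + ∫ₜ^∞ β N Z` and returns the value of `Z`
    -- at `-∞`, namely `y + ∫_ℝ β N Z`.
    (1 + k.total ∘L Ring.inverse (1 + k.volterra - constL X ∘L k.total) ∘L constL X)
    (by
      set R := Ring.inverse (1 + k.volterra) with hR
      set R' := Ring.inverse (1 + k.volterra - constL X ∘L k.total) with hR'
      have h2 : R' * (1 + k.volterra - constL X ∘L k.total) = 1 :=
        Ring.inverse_mul_cancel _ k.isUnit_one_add_volterra_sub_total
      intro x
      have e : (1 + k.volterra - constL X ∘L k.total) (k.sol x) =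
          constL X ((1 - k.total ∘L k.sol) x) := by
        have := k.sol_add_volterra x
        ext t
        have ht := DFunLike.congr_fun this t
        change k.sol x t + k.volterra (k.sol x) t - k.total (k.sol x) = x - k.total (k.sol x)
        have ht' : k.sol x t + k.volterra (k.sol x) t = x := ht
        rw [ht']
      have e2 : R' (constL X ((1 - k.total ∘L k.sol) x)) = k.sol x := by
        rw [← e]; exact DFunLike.congr_fun h2 _
      change (1 - k.total ∘L k.sol) x + k.total (R' (constL X ((1 - k.total ∘L k.sol) x))) = x
      rw [e2]
      change x - k.total (k.sol x) + k.total (k.sol x) = x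
      abel)
    (by
      set R' := Ring.inverse (1 + k.volterra - constL X ∘L k.total) with hR'
      have h1 : (1 + k.volterra - constL X ∘L k.total) * R' = 1 :=
        Ring.mul_inverse_cancel _ k.isUnit_one_add_volterra_sub_total
      intro y
      have e : (1 + k.volterra - constL X ∘L k.total) (R' (constL X y)) = constL X y :=
        DFunLike.congr_fun h1 _
      set x := (1 + k.total ∘L R' ∘L constL X) y with hx
      have hs : R' (constL X y) = k.sol x := by
        refine k.eq_sol fun t => ?_
        have ht : R' (constL X y) t + k.volterra (R' (constL X y)) t -
          k.total (R' (constL X y)) = y := DFunLike.congr_fun e t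
        rw [eq_sub_iff_add_eq, ← volterra_apply]
        have hx' : x = y + k.total (R' (constL X y)) := rfl
        rw [hx', ← sub_eq_iff_eq_add]
        exact ht
      change x - k.total (k.sol x) = y
      rw [← hs]
      change y + k.total (R' (constL X y)) - k.total (R' (constL X y)) = y
      abel)

theorem wave_apply (x : X) : k.wave x = x - k.total (k.sol x) := rfl

theorem sol_sub_wave (x : X) (t : ℝ) :
    k.sol x t - k.wave x = ∫ s in Ioi t, (k.weight s : ℂ) • k.op s (k.sol x s) := by
  rw [← total_sub_volterra_apply, wave_apply, k.sol_apply x t, ← volterra_apply]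
  abel

/-- The difference is the tail of the integral, and `Z` is bounded by `‖sol‖ ‖x‖`; the factor `2`
bounds `‖N‖`. -/
theorem norm_sol_sub_wave_le (x : X) (t : ℝ) :
    ‖k.sol x t - k.wave x‖ ≤ 2 * ‖k.sol‖ * ‖x‖ * ∫ s in Ioi t, k.weight s := by
  rw [sol_sub_wave]
  refine (k.norm_setIntegral_le (fun s =>
    ((k.sol x).norm_coe_le_norm s).trans (k.sol.le_opNorm x))
    (k.integrable_weight.mul_const _)).trans_eq ?_
  rw [integral_mul_const]; ring

end IntegralKernel
end Volterra

/-! ### Mild solutions relative to an isometric group. -/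

section Mild
open scoped BoundedContinuousFunction

variable {X : Type*} [NormedAddCommGroup X] [NormedSpace ℂ X]

/-- A strongly continuous one-parameter group of linear isometries. -/
structure IsometricFlow (X : Type*) [NormedAddCommGroup X] [NormedSpace ℂ X] where
  op : ℝ → X →L[ℂ] X
  op_zero : op 0 = 1
  op_add : ∀ s t, op (s + t) = op s * op t
  norm_op : ∀ t x, ‖op t x‖ = ‖x‖
  continuous_op : ∀ x, Continuous fun t => op t x

namespace IsometricFlow

variable (S : IsometricFlow X)

@[simp] theorem op_op_neg (t : ℝ) (x : X) : S.op t (S.op (-t) x) = x := by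
  have h := S.op_add t (-t)
  rw [add_neg_cancel, S.op_zero] at h
  exact (DFunLike.congr_fun h x).symm

@[simp] theorem op_neg_op (t : ℝ) (x : X) : S.op (-t) (S.op t x) = x := by
  simpa using S.op_op_neg (-t) x

theorem opNorm_le (t : ℝ) : ‖S.op t‖ ≤ 1 :=
  ContinuousLinearMap.opNorm_le_bound _ zero_le_one fun x => by rw [S.norm_op, one_mul]

theorem continuousOn_op_apply {f : ℝ → X} {s : Set ℝ} {g : ℝ → ℝ} (hg : Continuous g)
    (hf : ContinuousOn f s) : ContinuousOn (fun t => S.op (g t) (f t)) s := fun t ht =>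
  tendsto_clm_apply_of_norm_le (fun r => S.opNorm_le (g r)) (hf t ht)
    (((S.continuous_op (f t)).comp hg).continuousWithinAt (s := s) (x := t))

/-- Mild solutions of `U' = G U - 2 b P U`, `U 0 = x`, on `[0, ∞)`, where `G` generates `S`. -/
structure IsMild (P : X →L[ℂ] X) (b : ℝ → ℝ) (x : X) (U : ℝ → X) : Prop where
  continuousOn : ContinuousOn U (Ici 0)
  eq : ∀ t ∈ Ici (0 : ℝ), S.op (-t) (U t) =
    x - ∫ s in (0 : ℝ)..t, ((2 * b s : ℝ) : ℂ) • S.op (-s) (P (U s))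

variable {S}

theorem IsMild.initial {P : X →L[ℂ] X} {b : ℝ → ℝ} {x : X} {U : ℝ → X} (h : S.IsMild P b x U) :
    U 0 = x := by
  have := h.eq 0 self_mem_Ici
  simpa [S.op_zero] using this

theorem isMild_zero_iff {P : X →L[ℂ] X} {x : X} {U : ℝ → X} :
    S.IsMild P 0 x U ↔ ∀ t ∈ Ici (0 : ℝ), U t = S.op t x := by
  refine ⟨fun h t ht => ?_, fun h => ⟨?_, fun t ht => ?_⟩⟩
  · have := h.eq t ht
    simp only [Pi.zero_apply, mul_zero, Complex.ofReal_zero, zero_smul,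
      intervalIntegral.integral_zero, sub_zero] at this
    rw [← this, op_op_neg]
  · exact (S.continuous_op x).continuousOn.congr h
  · simp [h t ht]

variable (S)

/-- The kernel of the integral equation for `S(-t) U(t)`, with `b` cut off outside `I`. -/
noncomputable def kernel {P : X →L[ℂ] X} (hP : ‖P‖ ≤ 1) {b : ℝ → ℝ} {I : Set ℝ}
    (hI : MeasurableSet I) (hb : ∀ t ∈ I, 0 ≤ b t) (hbI : IntegrableOn b I) :
    IntegralKernel X where
  weight := I.indicator b
  op s := (2 : ℂ) • (S.op (-s) ∘L P ∘L S.op s)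
  integrable_weight := hbI.integrable_indicator hI
  weight_nonneg s := indicator_nonneg hb s
  norm_op_le s := by
    rw [norm_smul, Complex.norm_ofNat]
    have h : ‖S.op (-s) ∘L P ∘L S.op s‖ ≤ 1 := by
      refine ContinuousLinearMap.opNorm_le_bound _ zero_le_one fun x => ?_
      refine (S.norm_op _ _).trans_le ((P.le_of_opNorm_le hP _).trans ?_)
      exact congrArg (1 * ·) (S.norm_op s x) |>.le
    linarith
  continuous_op x := by
    refine Continuous.const_smul ?_ _
    exact continuousOn_univ.1 (S.continuousOn_op_apply continuous_neg
      (P.continuous.comp (S.continuous_op x)).continuousOn)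

section kernel

variable {P : X →L[ℂ] X} (hP : ‖P‖ ≤ 1) {b : ℝ → ℝ} {I : Set ℝ}
    (hI : MeasurableSet I) (hb : ∀ t ∈ I, 0 ≤ b t) (hbI : IntegrableOn b I)

theorem kernel_integrand (Z : ℝ → X) :
    (fun s => ((S.kernel hP hI hb hbI).weight s : ℂ) • (S.kernel hP hI hb hbI).op s (Z s)) =
      I.indicator fun s => ((2 * b s : ℝ) : ℂ) • S.op (-s) (P (S.op s (Z s))) := by
  ext s
  by_cases hs : s ∈ I
  · simp [kernel, hs, smul_smul, mul_comm]
  · simp [kernel, hs]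

theorem kernel_setIntegral {t τ : ℝ} (hτ : 0 ≤ τ) (h : Iic t ∩ I = Icc 0 τ) (Z : ℝ → X) :
    ∫ s in Iic t, ((S.kernel hP hI hb hbI).weight s : ℂ) •
        (S.kernel hP hI hb hbI).op s (Z s) =
      ∫ s in (0 : ℝ)..τ, ((2 * b s : ℝ) : ℂ) • S.op (-s) (P (S.op s (Z s))) := by
  rw [kernel_integrand, setIntegral_indicator hI, h, intervalIntegral.integral_of_le hτ,
    integral_Icc_eq_integral_Ioc]

theorem kernel_setIntegral_eq_zero {t : ℝ} (h : Iic t ∩ I = ∅) (Z : ℝ → X) :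
    ∫ s in Iic t, ((S.kernel hP hI hb hbI).weight s : ℂ) •
        (S.kernel hP hI hb hbI).op s (Z s) = 0 := by
  rw [kernel_integrand, setIntegral_indicator hI, h, setIntegral_empty]

end kernel

variable {S} [CompleteSpace X] {P : X →L[ℂ] X} {b : ℝ → ℝ}

/-- A mild solution is not known in advance to be bounded on `[0, ∞)`, so uniqueness is proved on
each `[0, T]`. There `S(-t)U(t)`, extended by its end values, is a bounded solution of the Volterra
equation with weight cut off outside `[0, T]`. -/
theorem IsMild.eqOn (hP : ‖P‖ ≤ 1) (hb : ∀ t, 0 ≤ t → 0 ≤ b t) (hbI : IntegrableOn b (Ici 0))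
    {x : X} {U V : ℝ → X} (hU : S.IsMild P b x U) (hV : S.IsMild P b x V) :
    EqOn U V (Ici 0) := by
  intro T hT
  have hT0 : (0 : ℝ) ≤ T := hT
  have hb' : ∀ t ∈ Icc 0 T, 0 ≤ b t := fun t ht => hb t ht.1
  have hbI' : IntegrableOn b (Icc 0 T) := hbI.mono_set Icc_subset_Ici_self
  set k := S.kernel hP measurableSet_Icc hb' hbI' with hk
  have key : ∀ U : ℝ → X, S.IsMild P b x U → S.op (-T) (U T) = k.sol x T := by
    intro U hU
    have hc : ContinuousOn (fun t => S.op (-t) (U t)) (Icc 0 T) :=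
      S.continuousOn_op_apply continuous_neg (hU.continuousOn.mono Icc_subset_Ici_self)
    obtain ⟨C, hC⟩ := isCompact_Icc.exists_bound_of_continuousOn hc
    set Z : ℝ →ᵇ X := BoundedContinuousFunction.ofNormedAddCommGroup
      (fun t => S.op (-(projIcc 0 T hT0 t : ℝ)) (U (projIcc 0 T hT0 t)))
      (hc.comp_continuous (continuous_subtype_val.comp continuous_projIcc)
        fun t => (projIcc 0 T hT0 t).2) C (fun t => hC _ (projIcc 0 T hT0 t).2) with hZ
    have hZp : ∀ t, Z t = S.op (-(projIcc 0 T hT0 t : ℝ)) (U (projIcc 0 T hT0 t)) :=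
      fun _ => rfl
    have hZin : ∀ t ∈ Icc 0 T, Z t = S.op (-t) (U t) := fun t ht => by
      rw [hZp, projIcc_of_mem hT0 ht]
    have hcongr : ∀ τ ∈ Icc 0 T, Z τ = x - ∫ s in (0 : ℝ)..τ,
        ((2 * b s : ℝ) : ℂ) • S.op (-s) (P (S.op s (Z s))) := by
      intro τ hτ
      rw [hZin τ hτ, hU.eq τ hτ.1]
      congr 1
      refine intervalIntegral.integral_congr fun s hs => ?_
      rw [uIcc_of_le hτ.1] at hs
      rw [hZin s ⟨hs.1, hs.2.trans hτ.2⟩, op_op_neg]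
    have hsol : Z = k.sol x := by
      refine k.eq_sol fun t => ?_
      rcases lt_or_ge t 0 with ht | ht
      · rw [S.kernel_setIntegral_eq_zero hP measurableSet_Icc hb' hbI'
          (by ext s; simp; intros; linarith)]
        have h0 := hcongr 0 ⟨le_rfl, hT0⟩
        rw [intervalIntegral.integral_same] at h0
        rw [← h0, hZp, hZp, projIcc_of_le_left hT0 ht.le, projIcc_of_le_left hT0 le_rfl]
      · rcases le_total t T with h | h
        · rw [S.kernel_setIntegral hP measurableSet_Icc hb' hbI' ht
            (by ext s; simp; constructor <;> intro h' <;> grind)]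
          exact hcongr t ⟨ht, h⟩
        · rw [S.kernel_setIntegral hP measurableSet_Icc hb' hbI' hT0
            (by ext s; simp; grind), ← hcongr T ⟨hT0, le_rfl⟩]
          rw [hZp, hZp, projIcc_of_right_le hT0 h, projIcc_of_right_le hT0 le_rfl]
    rw [← hsol, hZin T ⟨hT0, le_rfl⟩]
  rw [← S.op_op_neg T (U T), key U hU, ← key V hV, S.op_op_neg]

theorem isMild_sol (hP : ‖P‖ ≤ 1) (hb : ∀ t ∈ Ici 0, 0 ≤ b t) (hbI : IntegrableOn b (Ici 0))
    (x : X) : S.IsMild P b x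
      (fun t => S.op t ((S.kernel hP measurableSet_Ici hb hbI).sol x t)) where
  continuousOn := S.continuousOn_op_apply continuous_id
    (BoundedContinuousFunction.continuous _).continuousOn
  eq t ht := by
    rw [op_neg_op, IntegralKernel.sol_apply,
      S.kernel_setIntegral hP measurableSet_Ici hb hbI ht (by ext s; simp; grind)]

theorem IsMild.eq_sol (hP : ‖P‖ ≤ 1) (hb : ∀ t ∈ Ici 0, 0 ≤ b t) (hbI : IntegrableOn b (Ici 0))
    {x : X} {U : ℝ → X} (hU : S.IsMild P b x U) {t : ℝ} (ht : 0 ≤ t) :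
    U t = S.op t ((S.kernel hP measurableSet_Ici hb hbI).sol x t) :=
  hU.eqOn hP hb hbI (isMild_sol hP hb hbI x) ht

/-- Mild solutions depend continuously on their data, uniformly in time. -/
theorem exists_norm_sub_le (hP : ‖P‖ ≤ 1) (hb : ∀ t, 0 ≤ t → 0 ≤ b t)
    (hbI : IntegrableOn b (Ici 0)) : ∃ C, ∀ x y U V, S.IsMild P b x U → S.IsMild P b y V →
      ∀ t, 0 ≤ t → ‖U t - V t‖ ≤ C * ‖x - y‖ := by
  refine ⟨‖(S.kernel hP measurableSet_Ici hb hbI).sol‖, fun x y U V hU hV t ht => ?_⟩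
  rw [hU.eq_sol hP hb hbI ht, hV.eq_sol hP hb hbI ht, ← map_sub, S.norm_op,
    ← BoundedContinuousFunction.sub_apply, ← map_sub]
  exact (BoundedContinuousFunction.norm_coe_le_norm _ _).trans
    (ContinuousLinearMap.le_opNorm _ _)

theorem tendsto_setIntegral_Ioi (hbI : IntegrableOn b (Ici 0)) :
    Tendsto (fun t => ∫ τ in Ioi t, b τ) atTop (𝓝 0) := by
  have hbI' := hbI.mono_set Ioi_subset_Ici_self
  have h := (intervalIntegral_tendsto_integral_Ioi 0 hbI' tendsto_id).const_sub
    (∫ τ in Ioi 0, b τ)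
  rw [sub_self] at h
  refine h.congr' ?_
  filter_upwards [eventually_ge_atTop 0] with t ht
  have := intervalIntegral.integral_Ioi_sub_Ioi hbI' ht
  rw [id, ← this, sub_sub_cancel]

/-- Existence of the wave operator. -/
theorem exists_wave_operator (hP : ‖P‖ ≤ 1) (hb : ∀ t, 0 ≤ t → 0 ≤ b t)
    (hbI : IntegrableOn b (Ici 0)) : ∃ (W : X ≃L[ℂ] X) (C : ℝ), ∀ x U V,
      S.IsMild P b x U → S.IsMild P 0 (W x) V →
        (∀ t, 0 ≤ t → ‖U t - V t‖ ≤ C * ‖x‖ * ∫ τ in Ioi t, b τ) ∧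
        ∀ t, 0 ≤ t → ‖V t‖ = ‖W x‖ := by
  set k := S.kernel hP measurableSet_Ici hb hbI with hk
  refine ⟨k.wave, 2 * ‖k.sol‖, fun x U V hU hV => ⟨fun t ht => ?_, fun t ht => ?_⟩⟩
  -- Both solutions are `S(t)` applied to something, so the isometry reduces the claim to the
  -- estimate for `Z(t) - Wx`.
  · rw [hU.eq_sol hP hb hbI ht, isMild_zero_iff.1 hV t ht, ← map_sub, S.norm_op]
    refine (k.norm_sol_sub_wave_le x t).trans_eq ?_
    congr 1
    refine setIntegral_congr_fun measurableSet_Ioi fun s hs => ?_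
    exact indicator_of_mem (show s ∈ Ici 0 from ht.trans (le_of_lt hs)) b
  · rw [isMild_zero_iff.1 hV t ht, S.norm_op]

end IsometricFlow
end Mild

/-! ### The group of an unbounded generator, obtained from bounded cutoffs. -/

section Cutoff

theorem intervalIntegrable_weight_smul {X : Type*} [NormedAddCommGroup X] [NormedSpace ℂ X]
    {b : ℝ → ℝ} (hbI : IntegrableOn b (Ici 0)) {V : ℝ → X} (hV : ContinuousOn V (Ici 0)) {t : ℝ}
    (ht : 0 ≤ t) :
    IntervalIntegrable (fun s => ((2 * b s : ℝ) : ℂ) • V s) volume 0 t := by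
  have h1 : IntervalIntegrable (fun s => ((2 * b s : ℝ) : ℂ)) volume 0 t := by
    rw [intervalIntegrable_iff_integrableOn_Ioc_of_le ht]
    exact ((hbI.mono_set (fun s hs => hs.1.le)).const_mul 2).ofReal
  exact h1.smul_continuousOn (hV.mono fun s hs => by
    rw [uIcc_of_le ht] at hs; exact hs.1)

theorem continuousOn_uIcc_of_Ici {X : Type*} [TopologicalSpace X] {V : ℝ → X}
    (hV : ContinuousOn V (Ici 0)) {t : ℝ} (ht : 0 ≤ t) : ContinuousOn V (uIcc 0 t) :=
  hV.mono fun s hs => by rw [uIcc_of_le ht] at hs; exact hs.1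

theorem exp_apply_primitive {X : Type*} [NormedAddCommGroup X] [NormedSpace ℂ X] [CompleteSpace X]
    (G : X →L[ℂ] X) {f : ℝ → X} {T : ℝ} (hf : IntervalIntegrable f volume 0 T) (z : X) :
    NormedSpace.exp (T • G) (z + ∫ s in (0 : ℝ)..T, f s) =
      z + ∫ t in (0 : ℝ)..T, NormedSpace.exp (t • G) (G (z + ∫ s in (0 : ℝ)..t, f s) + f t) := by
  have hd : ∀ t : ℝ, HasDerivAt (fun t : ℝ => (NormedSpace.exp (t • G)).restrictScalars ℝ)
      ((NormedSpace.exp (t • G) * G).restrictScalars ℝ) t := fun t =>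
    ((ContinuousLinearMap.restrictScalarsL ℂ X X ℝ ℝ).hasFDerivAt.comp_hasDerivAt t
      (hasDerivAt_exp_smul_const G t))
  have hc : Continuous fun t : ℝ => (NormedSpace.exp (t • G) * G).restrictScalars ℝ := by
    refine (ContinuousLinearMap.restrictScalarsL ℂ X X ℝ ℝ).continuous.comp ?_
    exact (continuous_iff_continuousAt.2 fun t =>
      (hasDerivAt_exp_smul_const (𝕂 := ℝ) G t).continuousAt).mul continuous_const
  have h := clm_apply_primitive hd hc hf z
  simpa using h

variable {K : Type*} [NormedAddCommGroup K] [InnerProductSpace ℂ K] [CompleteSpace K]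

theorem exp_mem_unitary_of_mem_skewAdjoint {g : K →L[ℂ] K} (h : g ∈ skewAdjoint (K →L[ℂ] K)) :
    NormedSpace.exp g ∈ unitary (K →L[ℂ] K) := by
  let _ : NormedAlgebra ℚ (K →L[ℂ] K) := NormedAlgebra.restrictScalars ℚ ℂ _
  exact NormedSpace.exp_mem_unitary_of_mem_skewAdjoint h

/-- Bounded cutoffs `cut n → 1` of the identity, together with the bounded skew-adjoint cutoffs
`gen n` of an (unbounded) generator. -/
structure GeneratorCutoff (K : Type*) [NormedAddCommGroup K] [InnerProductSpace ℂ K]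
    [CompleteSpace K] where
  cut : ℕ → K →L[ℂ] K
  gen : ℕ → K →L[ℂ] K
  tendsto_cut : ∀ x, Tendsto (fun n => cut n x) atTop (𝓝 x)
  gen_mul_cut : ∀ {n m}, n < m → gen m * cut n = gen n
  cut_mul_gen : ∀ {n m}, n < m → cut n * gen m = gen n
  gen_skew : ∀ n, gen n ∈ skewAdjoint (K →L[ℂ] K)

namespace GeneratorCutoff

variable (c : GeneratorCutoff K)

/-- The approximate flows. -/
noncomputable def approx (n : ℕ) (t : ℝ) : K →L[ℂ] K := NormedSpace.exp (t • c.gen n)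

theorem norm_approx (n : ℕ) (t : ℝ) (x : K) : ‖c.approx n t x‖ = ‖x‖ := by
  have h : t • c.gen n ∈ skewAdjoint (K →L[ℂ] K) := by
    rw [skewAdjoint.mem_iff, star_smul, skewAdjoint.mem_iff.1 (c.gen_skew n), smul_neg]
    simp
  exact ContinuousLinearMap.norm_map_of_mem_unitary (exp_mem_unitary_of_mem_skewAdjoint h) x

/-- Both `cut n * gen l` and `gen m * cut n` equal `gen n`, so `cut n` intertwines the generators
and hence their exponentials. -/
theorem approx_mul_cut {n m l : ℕ} (hm : n < m) (hl : n < l) (t : ℝ) :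
    c.approx m t * c.cut n = c.cut n * c.approx l t := by
  let _ : NormedAlgebra ℚ (K →L[ℂ] K) := NormedAlgebra.restrictScalars ℚ ℂ _
  have h : SemiconjBy (c.cut n) (t • c.gen l) (t • c.gen m) := by
    rw [SemiconjBy, mul_smul_comm, smul_mul_assoc, c.cut_mul_gen hl, c.gen_mul_cut hm]
  exact h.exp_right.symm

/-- On the range of `cut n` the approximate flows no longer depend on the index once it exceeds `n`.
-/
theorem approx_cut {n m l : ℕ} (hm : n < m) (hl : n < l) (t : ℝ) (x : K) :
    c.approx m t (c.cut n x) = c.approx l t (c.cut n x) := by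
  have h := (c.approx_mul_cut hm hl t).trans (c.approx_mul_cut hl hl t).symm
  exact DFunLike.congr_fun h x

/-- The flows agree on `cut k x` and are isometric on the remainder. The bound is uniform in `t`, so
the limit flow is strongly continuous. -/
theorem norm_approx_sub_le {k n m : ℕ} (hn : k < n) (hm : k < m) (t : ℝ) (x : K) :
    ‖c.approx n t x - c.approx m t x‖ ≤ 2 * ‖x - c.cut k x‖ := by
  have h : c.approx n t x - c.approx m t x =
      c.approx n t (x - c.cut k x) - c.approx m t (x - c.cut k x) := by
    rw [map_sub, map_sub, c.approx_cut hn hm]; abel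
  rw [h]
  refine (norm_sub_le _ _).trans_eq ?_
  rw [norm_approx, norm_approx]; ring

theorem exists_norm_sub_cut_lt (x : K) {ε : ℝ} (hε : 0 < ε) :
    ∃ k, 2 * ‖x - c.cut k x‖ < ε := by
  have h : Tendsto (fun k => 2 * ‖x - c.cut k x‖) atTop (𝓝 0) := by
    simpa using (((c.tendsto_cut x).const_sub x).norm).const_mul 2
  exact (h.eventually (gt_mem_nhds hε)).exists

theorem exists_tendsto_approx (t : ℝ) :
    ∃ f : K → K, Tendsto (fun n x => c.approx n t x) atTop (𝓝 f) := by
  have h : ∀ x, ∃ y, Tendsto (fun n => c.approx n t x) atTop (𝓝 y) := fun x => by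
    refine cauchySeq_tendsto_of_complete (Metric.cauchySeq_iff.2 fun ε hε => ?_)
    obtain ⟨k, hk⟩ := c.exists_norm_sub_cut_lt x hε
    refine ⟨k + 1, fun n hn m hm => ?_⟩
    rw [dist_eq_norm]
    exact (c.norm_approx_sub_le hn hm t x).trans_lt hk
  choose f hf using h
  exact ⟨f, tendsto_pi_nhds.2 hf⟩

/-- The limit of the approximate flows. -/
noncomputable def flowOp (t : ℝ) : K →L[ℂ] K :=
  continuousLinearMapOfTendsto (c.approx · t) (c.exists_tendsto_approx t).choose_spec

theorem tendsto_approx (t : ℝ) (x : K) :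
    Tendsto (fun n => c.approx n t x) atTop (𝓝 (c.flowOp t x)) :=
  tendsto_pi_nhds.1 (c.exists_tendsto_approx t).choose_spec x

theorem opNorm_approx_le (n : ℕ) (t : ℝ) : ‖c.approx n t‖ ≤ 1 :=
  ContinuousLinearMap.opNorm_le_bound _ zero_le_one fun x => by rw [norm_approx, one_mul]

theorem continuous_approx (n : ℕ) : Continuous (c.approx n) :=
  continuous_iff_continuousAt.2 fun t => (hasDerivAt_exp_smul_const (𝕂 := ℝ) (c.gen n) t).continuousAt

/-- The isometric group generated by the limit of the `gen n`. -/
noncomputable def flow : IsometricFlow K where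
  op := c.flowOp
  op_zero := by
    ext x
    refine tendsto_nhds_unique (c.tendsto_approx 0 x) ?_
    simp [approx, NormedSpace.exp_zero]
  op_add s t := by
    ext x
    refine tendsto_nhds_unique (c.tendsto_approx (s + t) x) ?_
    let _ : NormedAlgebra ℚ (K →L[ℂ] K) := NormedAlgebra.restrictScalars ℚ ℂ _
    have h : ∀ n, c.approx n (s + t) x = c.approx n s (c.approx n t x) := fun n => by
      have h' : c.approx n (s + t) = c.approx n s * c.approx n t := by
        rw [approx, add_smul]
        exact NormedSpace.exp_add_of_commute
          (((Commute.refl (c.gen n)).smul_left s).smul_right t)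
      rw [h']; rfl
    simp_rw [h]
    exact tendsto_clm_apply_of_norm_le (fun n => c.opNorm_approx_le n s) (c.tendsto_approx t x)
      (c.tendsto_approx s _)
  norm_op t x := by
    refine tendsto_nhds_unique (c.tendsto_approx t x).norm ?_
    simp [norm_approx]
  continuous_op x := by
    have hu : TendstoUniformly (fun n t => c.approx n t x) (fun t => c.flowOp t x) atTop := by
      refine Metric.tendstoUniformly_iff.2 fun ε hε => ?_
      obtain ⟨k, hk⟩ := c.exists_norm_sub_cut_lt x hε
      filter_upwards [eventually_gt_atTop k] with n hn t
      rw [dist_eq_norm]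
      refine lt_of_le_of_lt ?_ hk
      refine le_of_tendsto ((c.tendsto_approx t x).sub_const _).norm ?_
      filter_upwards [eventually_gt_atTop k] with m hm
      exact c.norm_approx_sub_le hm hn t x
    exact hu.continuous (Frequently.of_forall fun n =>
      (c.continuous_approx n).clm_apply continuous_const)

/-- After a cutoff the limit flow is the exponential of a bounded operator, to which ordinary
differentiation applies. -/
theorem cut_flow (n : ℕ) (t : ℝ) (x : K) :
    c.cut n (c.flow.op t x) = c.approx (n + 1) t (c.cut n x) := by
  refine tendsto_nhds_unique (((c.cut n).continuous.tendsto _).comp (c.tendsto_approx t x))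
    (tendsto_const_nhds.congr' ?_)
  filter_upwards [eventually_gt_atTop n] with m hm
  exact DFunLike.congr_fun (c.approx_mul_cut n.lt_succ_self hm t) x

/-- An operator which anticommutes with the generators reverses the time. -/
theorem reflect_flow {J : K →L[ℂ] K} (hJ : ∀ n, J * c.gen n = -(c.gen n * J)) (t : ℝ) (x : K) :
    J (c.flow.op t x) = c.flow.op (-t) (J x) := by
  let _ : NormedAlgebra ℚ (K →L[ℂ] K) := NormedAlgebra.restrictScalars ℚ ℂ _
  have hn : ∀ n, J (c.approx n t x) = c.approx n (-t) (J x) := fun n => by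
    have h : SemiconjBy J (t • c.gen n) ((-t) • c.gen n) := by
      rw [SemiconjBy, mul_smul_comm, smul_mul_assoc, hJ, neg_smul, ← smul_neg]
    exact DFunLike.congr_fun h.exp_right x
  refine tendsto_nhds_unique ((J.continuous.tendsto _).comp (c.tendsto_approx t x)) ?_
  exact (c.tendsto_approx (-t) (J x)).congr fun n => (hn n).symm

/-- Weak solutions of `U' = G U - 2 b P U` on `[0, ∞)`, tested with the cutoffs. -/
structure IsWeak (P : K →L[ℂ] K) (b : ℝ → ℝ) (U : ℝ → K) : Prop where
  continuousOn : ContinuousOn U (Ici 0)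
  eq : ∀ n, ∀ t ∈ Ici (0 : ℝ), c.cut n (U t) = c.cut n (U 0) +
    ∫ s in (0 : ℝ)..t, (c.gen n (U s) - ((2 * b s : ℝ) : ℂ) • c.cut n (P (U s)))

variable {c} {P : K →L[ℂ] K} {b : ℝ → ℝ} {U : ℝ → K}

theorem gen_cut (n : ℕ) (x : K) : c.gen (n + 1) (c.cut n x) = c.gen n x :=
  DFunLike.congr_fun (c.gen_mul_cut n.lt_succ_self) x

/-- `cut n U` solves an equation with the bounded generator `gen (n + 1)`. Applying `exp(-t gen (n +
1))` and the product rule cancels the generator terms; letting `n → ∞` removes the cutoff. -/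
theorem IsWeak.isMild (hbI : IntegrableOn b (Ici 0)) (h : c.IsWeak P b U) :
    c.flow.IsMild P b (U 0) U where
  continuousOn := h.continuousOn
  eq t ht := by
    have hi : IntervalIntegrable
        (fun s => ((2 * b s : ℝ) : ℂ) • c.flow.op (-s) (P (U s))) volume 0 t :=
      intervalIntegrable_weight_smul hbI (c.flow.continuousOn_op_apply continuous_neg
      (P.continuous.comp_continuousOn h.continuousOn)) ht
    refine tendsto_nhds_unique ((c.tendsto_cut _).congr fun n => ?_) (c.tendsto_cut _)
    have hf : IntervalIntegrable
        (fun s => c.gen n (U s) - ((2 * b s : ℝ) : ℂ) • c.cut n (P (U s))) volume 0 t :=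
      (((c.gen n).continuous.comp_continuousOn
        (continuousOn_uIcc_of_Ici h.continuousOn ht)).intervalIntegrable).sub
        (intervalIntegrable_weight_smul hbI ((c.cut n).continuous.comp_continuousOn
          (P.continuous.comp_continuousOn h.continuousOn)) ht)
    have key := exp_apply_primitive (-c.gen (n + 1)) hf (c.cut n (U 0))
    have hexp : ∀ s : ℝ, NormedSpace.exp (s • -c.gen (n + 1)) = c.approx (n + 1) (-s) :=
      fun s => by rw [approx, smul_neg, neg_smul]
    simp_rw [hexp] at key
    rw [← h.eq n t ht, ← cut_flow] at key
    rw [key, map_sub, sub_eq_add_neg, ← ContinuousLinearMap.intervalIntegral_comp_comm _ hi,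
      ← intervalIntegral.integral_neg]
    congr 1
    refine intervalIntegral.integral_congr fun s hs => ?_
    rw [uIcc_of_le ht] at hs
    rw [← h.eq n s hs.1, _root_.neg_apply, gen_cut, sub_eq_add_neg, neg_add_cancel_left]
    simp only [map_smul, map_neg, cut_flow]

/-- The reverse computation: apply `exp(t gen (n + 1))` to the primitive `cut n (S(-t)U(t))`. No
limit is needed, because the weak equation is already cut off. -/
theorem isWeak_of_isMild (hbI : IntegrableOn b (Ici 0)) (h : c.flow.IsMild P b (U 0) U) :
    c.IsWeak P b U where
  continuousOn := h.continuousOn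
  eq n t ht := by
    have hi : ∀ t ∈ Ici (0 : ℝ), IntervalIntegrable
        (fun s => ((2 * b s : ℝ) : ℂ) • c.flow.op (-s) (P (U s))) volume 0 t := fun t ht =>
      intervalIntegrable_weight_smul hbI (c.flow.continuousOn_op_apply continuous_neg
        (P.continuous.comp_continuousOn h.continuousOn)) ht
    have hf : IntervalIntegrable
        (fun s => -(c.cut n (((2 * b s : ℝ) : ℂ) • c.flow.op (-s) (P (U s))))) volume 0 t := by
      refine IntervalIntegrable.neg ?_
      simp_rw [map_smul]
      exact intervalIntegrable_weight_smul hbI ((c.cut n).continuous.comp_continuousOn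
        (c.flow.continuousOn_op_apply continuous_neg
          (P.continuous.comp_continuousOn h.continuousOn))) ht
    have hZ : ∀ s ∈ Ici (0 : ℝ), c.cut n (U 0) + ∫ r in (0 : ℝ)..s,
        -(c.cut n (((2 * b r : ℝ) : ℂ) • c.flow.op (-r) (P (U r)))) =
        c.cut n (c.flow.op (-s) (U s)) := fun s hs => by
      rw [h.eq s hs, map_sub, intervalIntegral.integral_neg,
        ContinuousLinearMap.intervalIntegral_comp_comm _ (hi s hs), sub_eq_add_neg]
    have key := exp_apply_primitive (c.gen (n + 1)) hf (c.cut n (U 0))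
    change c.approx (n + 1) t _ = _ + ∫ s in (0 : ℝ)..t, c.approx (n + 1) s _ at key
    rw [hZ t ht, ← cut_flow, IsometricFlow.op_op_neg] at key
    rw [key]
    congr 1
    refine intervalIntegral.integral_congr fun s hs => ?_
    rw [uIcc_of_le ht] at hs
    rw [hZ s hs.1, map_add, map_neg, map_smul, map_smul, ← cut_flow,
      IsometricFlow.op_op_neg, sub_eq_add_neg]
    congr 1
    have hcomm : Commute (c.approx (n + 1) s) (c.gen (n + 1)) :=
      ((Commute.refl (c.gen (n + 1))).smul_left s).exp_left
    refine (DFunLike.congr_fun hcomm _).trans ?_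
    change c.gen (n + 1) (c.approx (n + 1) s (c.cut n (c.flow.op (-s) (U s)))) = _
    rw [← cut_flow, IsometricFlow.op_op_neg, gen_cut]

end GeneratorCutoff
end Cutoff

/-! ### Resolvent, square root and spectral cutoffs of `A`. -/

section Operators

variable {H : Type*} [NormedAddCommGroup H] [InnerProductSpace ℂ H]

theorem IsNonneg.re_inner_nonneg {T : H →ₗ.[ℂ] H} (h : IsNonneg T) {x y : H}
    (hxy : (x, y) ∈ T.graph) : 0 ≤ (⟪y, x⟫_ℂ).re := by
  obtain ⟨z, rfl, rfl⟩ := (LinearPMap.mem_graph_iff T).1 hxy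
  exact h z

/-- `R` is the resolvent `(1 + A)⁻¹`. -/
structure IsResolvent (A : H →ₗ.[ℂ] H) (R : H →L[ℂ] H) : Prop where
  mem_graph_iff : ∀ x y, (x, y) ∈ A.graph ↔ R (x + y) = x
  norm_le : ‖R‖ ≤ 1
  isPositive : R.IsPositive

theorem IsResolvent.mem_graph {A : H →ₗ.[ℂ] H} {R : H →L[ℂ] H} (h : IsResolvent A R) (x : H) :
    (R x, x - R x) ∈ A.graph :=
  (h.mem_graph_iff _ _).2 (by rw [add_sub_cancel])

variable [CompleteSpace H]

theorem mem_graph_iff_of_isSelfAdjoint {T : H →ₗ.[ℂ] H} (hT : IsSelfAdjoint T) (x y : H) :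
    (x, y) ∈ T.graph ↔ ∀ u v, (u, v) ∈ T.graph → ⟪v, x⟫_ℂ = ⟪u, y⟫_ℂ := by
  have h := LinearPMap.adjoint_graph_eq_graph_adjoint hT.dense_domain
  rw [LinearPMap.isSelfAdjoint_def.1 hT] at h
  conv_lhs => rw [h]
  simp only [Submodule.mem_adjoint_iff, sub_eq_zero]

theorem isSelfAdjoint_of_mem_graph_iff {T : H →ₗ.[ℂ] H} (hd : Dense (T.domain : Set H))
    (hT : ∀ x y, (∀ u v, (u, v) ∈ T.graph → ⟪v, x⟫_ℂ = ⟪u, y⟫_ℂ) ↔ (x, y) ∈ T.graph) :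
    IsSelfAdjoint T := by
  refine LinearPMap.eq_of_eq_graph ?_
  change T.adjoint.graph = T.graph
  rw [LinearPMap.adjoint_graph_eq_graph_adjoint hd]
  ext ⟨x, y⟩
  simp only [Submodule.mem_adjoint_iff, sub_eq_zero]
  exact hT x y

/-- Non-negativity gives `‖x‖ ≤ ‖x + Ax‖`, so `1 + A` is injective with closed range. A vector `u`
orthogonal to the range satisfies `Au = -u` by self-adjointness, and non-negativity forces `u = 0`.
Working on the closed graph supplies completeness. -/
theorem exists_isResolvent {A : H →ₗ.[ℂ] H} (hA : IsSelfAdjoint A) (hA0 : IsNonneg A) :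
    ∃ R, IsResolvent A R := by
  have hle : ∀ x y, (x, y) ∈ A.graph → ‖x‖ ≤ ‖x + y‖ := fun x y hxy => by
    rcases eq_or_ne x 0 with rfl | hx
    · simp
    refine le_of_mul_le_mul_right ?_ (norm_pos_iff.2 hx)
    calc ‖x‖ * ‖x‖ = (⟪x, x⟫_ℂ).re := (inner_self_eq_norm_mul_norm (𝕜 := ℂ) x).symm
      _ ≤ (⟪x + y, x⟫_ℂ).re := by
        rw [inner_add_left, Complex.add_re]
        linarith [hA0.re_inner_nonneg hxy]
      _ ≤ ‖x + y‖ * ‖x‖ := re_inner_le_norm (𝕜 := ℂ) _ _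
  set f : A.graph →L[ℂ] H :=
    (ContinuousLinearMap.fst ℂ H H + ContinuousLinearMap.snd ℂ H H) ∘L A.graph.subtypeL with hf
  have hfa : ∀ p : A.graph, f p = p.1.1 + p.1.2 := fun p => rfl
  have hanti : AntilipschitzWith 2 f := by
    refine AddMonoidHomClass.antilipschitz_of_bound f fun p => ?_
    have h1 := hle p.1.1 p.1.2 p.2
    have h2 : ‖p.1.2‖ ≤ ‖p.1.1 + p.1.2‖ + ‖p.1.1‖ := by
      simpa using norm_sub_le (p.1.1 + p.1.2) p.1.1
    rw [hfa]
    change max ‖p.1.1‖ ‖p.1.2‖ ≤ _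
    have h0 := norm_nonneg (p.1.1 + p.1.2)
    exact max_le (by push_cast; linarith) (by push_cast; linarith)
  have : CompleteSpace A.graph := (hA.isClosed).completeSpace_coe
  have hclosed : IsClosed (f.range : Set H) := by
    exact hanti.isClosed_range f.uniformContinuous
  have htop : f.range = ⊤ := by
    have : CompleteSpace f.range := hclosed.completeSpace_coe
    rw [← Submodule.orthogonal_eq_bot_iff, Submodule.eq_bot_iff]
    intro u hu
    have hmem : (u, -u) ∈ A.graph := by
      refine (mem_graph_iff_of_isSelfAdjoint hA _ _).2 fun x y hxy => ?_
      have h := (Submodule.mem_orthogonal _ _).1 hu (x + y) ⟨⟨(x, y), hxy⟩, rfl⟩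
      rw [inner_add_left] at h
      rw [inner_neg_right]
      exact eq_neg_of_add_eq_zero_right h
    have h := hA0.re_inner_nonneg hmem
    rw [inner_neg_left, Complex.neg_re] at h
    have h2 : (⟪u, u⟫_ℂ).re = ‖u‖ * ‖u‖ := inner_self_eq_norm_mul_norm (𝕜 := ℂ) u
    rw [← norm_eq_zero]
    nlinarith [norm_nonneg u]
  set e : A.graph ≃ₗ[ℂ] H := LinearEquiv.ofBijective (f : A.graph →ₗ[ℂ] H)
    ⟨hanti.injective, LinearMap.range_eq_top.1 htop⟩ with he
  have hea : ∀ p : A.graph, e p = p.1.1 + p.1.2 := fun p => rfl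
  have hes : ∀ w, (e.symm w).1.1 + (e.symm w).1.2 = w := fun w => by
    rw [← hea, e.apply_symm_apply]
  set R : H →L[ℂ] H := LinearMap.mkContinuous
    (LinearMap.fst ℂ H H ∘ₗ A.graph.subtype ∘ₗ e.symm.toLinearMap) 1 (fun w => by
      rw [one_mul]
      exact (hle _ _ (e.symm w).2).trans_eq (congrArg norm (hes w))) with hR
  have hRa : ∀ w, R w = (e.symm w).1.1 := fun w => rfl
  have hmem : ∀ w, (R w, w - R w) ∈ A.graph := fun w => by
    have h := (e.symm w).2
    have h2 : (e.symm w).1 = (R w, w - R w) := by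
      refine Prod.ext rfl ?_
      rw [hRa]
      exact eq_sub_of_add_eq' (hes w)
    rwa [h2] at h
  have hsymm : ∀ x y, ⟪R x, y⟫_ℂ = ⟪x, R y⟫_ℂ := fun x y => by
    have h := (mem_graph_iff_of_isSelfAdjoint hA _ _).1 (hmem y) _ _ (hmem x)
    rw [inner_sub_left, inner_sub_right] at h
    exact (sub_left_inj.1 h).symm
  refine ⟨R, fun x y => ⟨fun h => ?_, fun h => ?_⟩,
    LinearMap.mkContinuous_norm_le _ zero_le_one _, ?_⟩
  · have h2 : e ⟨(x, y), h⟩ = x + y := rfl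
    rw [hRa, ← h2, e.symm_apply_apply]
  · have := hmem (x + y)
    rwa [h, add_sub_cancel_left] at this
  · refine ⟨fun x y => hsymm x y, fun x => ?_⟩
    change 0 ≤ (⟪R x, x⟫_ℂ).re
    have h := hA0.re_inner_nonneg (hmem x)
    have h2 : ⟪R x, x⟫_ℂ = ⟪R x, R x⟫_ℂ + ⟪x - R x, R x⟫_ℂ := by
      rw [← inner_add_left, add_sub_cancel, hsymm]
    have h3 : (⟪R x, R x⟫_ℂ).re = ‖R x‖ * ‖R x‖ := inner_self_eq_norm_mul_norm (𝕜 := ℂ) (R x)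
    rw [h2, Complex.add_re, h3]
    have := norm_nonneg (R x)
    positivity

namespace IsResolvent

variable {A : H →ₗ.[ℂ] H} {R : H →L[ℂ] H}

theorem denseRange (h : IsResolvent A R) (hA : IsSelfAdjoint A) : DenseRange R := by
  refine hA.dense_domain.mono fun x hx => ⟨x + A ⟨x, hx⟩, ?_⟩
  exact (h.mem_graph_iff _ _).1 (A.mem_graph ⟨x, hx⟩)

theorem isSelfAdjoint (h : IsResolvent A R) : IsSelfAdjoint R := h.isPositive.isSelfAdjoint

theorem spectrum_subset (h : IsResolvent A R) : spectrum ℝ R ⊆ Icc 0 1 := by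
  intro r hr
  have h0 : 0 ≤ r := spectrum_nonneg_of_nonneg
    ((ContinuousLinearMap.nonneg_iff_isPositive R).2 h.isPositive) hr
  refine ⟨h0, ?_⟩
  have h1 := spectrum.norm_le_norm_mul_of_mem hr
  have h2 : ‖(1 : H →L[ℂ] H)‖ ≤ 1 := ContinuousLinearMap.norm_id_le
  rw [Real.norm_of_nonneg h0] at h1
  nlinarith [h.norm_le, norm_nonneg R, norm_nonneg (1 : H →L[ℂ] H)]

/-- A non-negative self-adjoint operator has a non-negative self-adjoint square root. -/
theorem exists_isNonnegSqrt (h : IsResolvent A R) (hA : IsSelfAdjoint A) :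
    ∃ L, IsNonnegSqrt A L := by
  -- Since `A = (1 - R) / R`, its square root should be `√(1 - R) / √R`. Its graph is taken to be
  -- `{(Qw, Jw)}`, which avoids dividing by the possibly non-invertible `Q`.
  set Q : H →L[ℂ] H := cfc (fun r : ℝ => √r) R with hQ
  set J : H →L[ℂ] H := cfc (fun r : ℝ => √(1 - r)) R with hJ
  have hR := h.isSelfAdjoint
  have hQs : IsSelfAdjoint Q := cfc_predicate _ _
  have hJs : IsSelfAdjoint J := cfc_predicate _ _
  have hQQ : Q * Q = R := by
    rw [hQ, ← cfc_mul _ _ R]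
    conv_rhs => rw [← cfc_id' ℝ R]
    exact cfc_congr fun r hr => Real.mul_self_sqrt (h.spectrum_subset hr).1
  have hJJ : J * J = 1 - R := by
    rw [hJ, ← cfc_mul _ _ R]
    conv_rhs => rw [← cfc_id' ℝ R, ← cfc_one ℝ R, ← cfc_sub _ _ R]
    exact cfc_congr fun r hr => Real.mul_self_sqrt (sub_nonneg.2 (h.spectrum_subset hr).2)
  have hQJ : Commute Q J := cfc_commute_cfc _ _ R
  have hQJ0 : (Q * J).IsPositive := by
    rw [← ContinuousLinearMap.nonneg_iff_isPositive, hQ, hJ, ← cfc_mul _ _ R]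
    exact cfc_nonneg fun r _ => by positivity
  have eQQ : ∀ x, Q (Q x) = R x := fun x => DFunLike.congr_fun hQQ x
  have eJJ : ∀ x, J (J x) = x - R x := fun x => DFunLike.congr_fun hJJ x
  have eQJ : ∀ x, Q (J x) = J (Q x) := fun x => DFunLike.congr_fun hQJ x
  have sQ : ∀ x y, ⟪Q x, y⟫_ℂ = ⟪x, Q y⟫_ℂ := fun x y => hQs.isSymmetric x y
  have sJ : ∀ x y, ⟪J x, y⟫_ℂ = ⟪x, J y⟫_ℂ := fun x y => hJs.isSymmetric x y
  set G : Submodule ℂ (H × H) := LinearMap.range ((Q.prod J : H →L[ℂ] H × H) : H →ₗ[ℂ] H × H)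
    with hG
  have hGm : ∀ x y, (x, y) ∈ G ↔ ∃ w, Q w = x ∧ J w = y := fun x y => by
    simp [hG, Prod.ext_iff]
  have hGinj : ∀ p : H × H, p ∈ G → p.1 = 0 → p.2 = 0 := by
    rintro ⟨x, y⟩ hp (rfl : x = 0)
    obtain ⟨w, hw, rfl⟩ := (hGm _ _).1 hp
    have hw0 : R w = 0 := by rw [← eQQ, hw, map_zero]
    have := h.mem_graph w
    rw [hw0, sub_zero] at this
    have hw' : w = 0 := A.graph_fst_eq_zero_snd this rfl
    rw [hw', map_zero]
  set L : H →ₗ.[ℂ] H := G.toLinearPMap with hL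
  have hLG : L.graph = G := Submodule.toLinearPMap_graph_eq G hGinj
  have hLm : ∀ x y, (x, y) ∈ L.graph ↔ ∃ w, Q w = x ∧ J w = y := fun x y => by rw [hLG, hGm]
  refine ⟨L, ?_, ?_, ?_⟩
  · refine isSelfAdjoint_of_mem_graph_iff ?_ fun x y => ⟨fun hxy => ?_, fun hxy u v huv => ?_⟩
    · refine Dense.mono ?_ (h.denseRange hA)
      rintro _ ⟨x, rfl⟩
      exact LinearPMap.mem_domain_iff.2 ⟨J (Q x), (hLm _ _).2 ⟨Q x, eQQ x, rfl⟩⟩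
    · have hJQ : J x = Q y := ext_inner_left ℂ fun w => by
        rw [← sJ, ← sQ]
        exact hxy _ _ ((hLm _ _).2 ⟨w, rfl, rfl⟩)
      -- Because `Q² + J² = 1`, a pair `(Qw, Jw)` recovers its parameter as `w = Q(Qw) + J(Jw)`.
      refine (hLm _ _).2 ⟨Q x + J y, ?_, ?_⟩
      · rw [map_add, eQQ, eQJ, ← hJQ, eJJ, add_sub_cancel]
      · rw [map_add, eJJ, ← eQJ, hJQ, eQQ, add_sub_cancel]
    · obtain ⟨w, rfl, rfl⟩ := (hLm _ _).1 hxy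
      obtain ⟨z, rfl, rfl⟩ := (hLm _ _).1 huv
      rw [sJ, sQ, eQJ]
  · intro x
    obtain ⟨w, hw1, hw2⟩ := (hLm _ _).1 (L.mem_graph x)
    rw [← hw2, ← hw1, ← sQ]
    exact hQJ0.re_inner_nonneg_left w
  · intro x y
    rw [h.mem_graph_iff]
    constructor
    · intro hxy
      set w := x + y with hw
      have hy : y = w - R w := by rw [hxy, hw, add_sub_cancel_left]
      refine ⟨J (Q w), (hLm _ _).2 ⟨Q w, ?_, rfl⟩, (hLm _ _).2 ⟨J w, eQJ w, ?_⟩⟩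
      · rw [eQQ, hxy]
      · rw [eJJ, hy]
    · rintro ⟨z, h1, h2⟩
      obtain ⟨v, rfl, hv⟩ := (hLm _ _).1 h1
      obtain ⟨k, hk, rfl⟩ := (hLm _ _).1 h2
      have hvk : Q (Q v + J k) = v := by
        rw [map_add, eQQ, eQJ, hk, ← hv, eJJ, add_sub_cancel]
      have h3 : R (Q v + J k) = Q (Q (Q v + J k)) := (eQQ _).symm
      rw [h3, hvk]

end IsResolvent

/-- Existence of a square root suffices here: all later arguments use only the properties in
`IsNonnegSqrt`, not uniqueness. -/
theorem isNonnegSqrt_sqrtOp {A : H →ₗ.[ℂ] H} (hA : IsSelfAdjoint A) (hA0 : IsNonneg A) :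
    IsNonnegSqrt A (sqrtOp A) := by
  obtain ⟨R, hR⟩ := exists_isResolvent hA hA0
  exact Classical.epsilon_spec (hR.exists_isNonnegSqrt hA)

/-- Bounded self-adjoint cutoffs `cut n → 1` such that `lam n = L ∘ cut n` is bounded. -/
structure SpectralCutoff (L : H →ₗ.[ℂ] H) where
  cut : ℕ → H →L[ℂ] H
  lam : ℕ → H →L[ℂ] H
  cut_selfAdjoint : ∀ n, IsSelfAdjoint (cut n)
  lam_selfAdjoint : ∀ n, IsSelfAdjoint (lam n)
  tendsto_cut : ∀ x, Tendsto (fun n => cut n x) atTop (𝓝 x)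
  mem_graph : ∀ n x, (cut n x, lam n x) ∈ L.graph
  cut_mul_cut : ∀ {n m}, n < m → cut m * cut n = cut n

/-- The bounded operator `√A (1 + A)⁻¹`. -/
theorem IsNonnegSqrt.exists_sqrt_mul_resolvent {A L : H →ₗ.[ℂ] H} {R : H →L[ℂ] H}
    (hL : IsNonnegSqrt A L) (h : IsResolvent A R) : ∃ T : H →L[ℂ] H, IsSelfAdjoint T ∧
      Commute R T ∧ ∀ x, (R x, T x) ∈ L.graph := by
  have hex : ∀ x, ∃ z, (R x, z) ∈ L.graph ∧ (z, x - R x) ∈ L.graph := fun x =>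
    (hL.sq _ _).1 (h.mem_graph x)
  choose f hf1 hf2 using hex
  -- `f x` is `ΛRx`, so `‖f x‖² = ⟪Λ²Rx, Rx⟫ = ⟪x - Rx, Rx⟫ ≤ 2‖x‖²`.
  have hbd : ∀ x, ‖f x‖ ≤ 2 * ‖x‖ := fun x => by
    have h1 := (mem_graph_iff_of_isSelfAdjoint hL.selfAdjoint _ _).1 (hf1 x) _ _ (hf2 x)
    have hRx : ‖R x‖ ≤ ‖x‖ := by simpa using R.le_of_opNorm_le h.norm_le x
    have h2 : ‖x - R x‖ ≤ 2 * ‖x‖ := (norm_sub_le _ _).trans (by linarith)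
    have h3 : ‖f x‖ * ‖f x‖ = (⟪f x, f x⟫_ℂ).re := (inner_self_eq_norm_mul_norm (𝕜 := ℂ) _).symm
    have h4 : (⟪x - R x, R x⟫_ℂ).re ≤ ‖x - R x‖ * ‖R x‖ := re_inner_le_norm (𝕜 := ℂ) _ _
    rw [← h1, h1] at h3
    rw [h1] at h4
    have h5 : ‖x - R x‖ * ‖R x‖ ≤ 2 * ‖x‖ * ‖x‖ := by gcongr
    refine abs_le_of_sq_le_sq' ?_ (by positivity) |>.2
    nlinarith [norm_nonneg x]
  set T : H →L[ℂ] H := LinearMap.mkContinuous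
    { toFun := f
      map_add' := fun x y => L.mem_graph_snd_inj (hf1 (x + y))
        (L.graph.add_mem (hf1 x) (hf1 y)) (map_add R x y)
      map_smul' := fun c x => L.mem_graph_snd_inj (hf1 (c • x))
        (L.graph.smul_mem c (hf1 x)) (map_smul R c x) } 2 hbd with hT
  have hTf : ∀ x, T x = f x := fun x => rfl
  have sym := fun {x y u v : H} (hxy : (x, y) ∈ L.graph) (huv : (u, v) ∈ L.graph) =>
    (mem_graph_iff_of_isSelfAdjoint hL.selfAdjoint _ _).1 hxy u v huv
  refine ⟨T, ?_, ?_, hf1⟩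
  · rw [ContinuousLinearMap.isSelfAdjoint_iff_isSymmetric]
    intro x y
    change ⟪f x, y⟫_ℂ = ⟪x, f y⟫_ℂ
    have h1 : ⟪f x, R y⟫_ℂ = ⟪R x, f y⟫_ℂ := sym (hf1 y) (hf1 x)
    have h2 : ⟪x - R x, f y⟫_ℂ = ⟪f x, y - R y⟫_ℂ := sym (hf2 y) (hf2 x)
    rw [inner_sub_left, inner_sub_right, h1] at h2
    exact (sub_left_inj.1 h2).symm
  · ext x
    change R (T x) = T (R x)
    -- Applying `Λ` to `A(Rx) = x - Rx` at the point `Rx` shows `A(TRx) = Tx - TRx`, that is, `TRx =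
    -- R(Tx)`.
    have h1 : (f (R x), f x - f (R x)) ∈ A.graph := by
      refine (hL.sq _ _).2 ⟨R x - R (R x), hf2 (R x), ?_⟩
      exact L.graph.sub_mem (hf1 x) (hf1 (R x))
    have h2 := (h.mem_graph_iff _ _).1 h1
    rwa [add_sub_cancel] at h2

/-- The continuous cutoff functions, `0` for `r ≤ 2⁻ⁿ` and `1` for `r ≥ 2⁻ⁿ⁺¹`. -/
noncomputable def cutoffFun (n : ℕ) (r : ℝ) : ℝ := max 0 (min 1 (2 ^ n * r - 1))

theorem continuous_cutoffFun (n : ℕ) : Continuous (cutoffFun n) := by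
  unfold cutoffFun; fun_prop

theorem cutoffFun_nonneg (n : ℕ) (r : ℝ) : 0 ≤ cutoffFun n r := le_max_left _ _

theorem cutoffFun_le_one (n : ℕ) (r : ℝ) : cutoffFun n r ≤ 1 :=
  max_le zero_le_one (min_le_left _ _)

theorem cutoffFun_eq_zero {n : ℕ} {r : ℝ} (h : 2 ^ n * r ≤ 1) : cutoffFun n r = 0 :=
  max_eq_left ((min_le_right _ _).trans (by linarith))

theorem cutoffFun_eq_one {n : ℕ} {r : ℝ} (h : 2 ≤ 2 ^ n * r) : cutoffFun n r = 1 := by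
  rw [cutoffFun, min_eq_left (by linarith), max_eq_right zero_le_one]

/-- Where the `n`-th cutoff is non-zero, `2ⁿ r > 1`; hence `2ᵐ r ≥ 2 · 2ⁿ r > 2` and the `m`-th one
equals `1`. This is why the scales are dyadic. -/
theorem cutoffFun_mul_cutoffFun {n m : ℕ} (h : n < m) (r : ℝ) :
    cutoffFun m r * cutoffFun n r = cutoffFun n r := by
  rcases le_or_gt (2 ^ n * r) 1 with h1 | h1
  · rw [cutoffFun_eq_zero h1, mul_zero]
  · have hr : 0 < r := by
      by_contra hr
      have : (2 : ℝ) ^ n * r ≤ 0 := mul_nonpos_of_nonneg_of_nonpos (by positivity) (not_lt.1 hr)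
      linarith
    have h2 : (2 : ℝ) ^ (n + 1) ≤ 2 ^ m := pow_le_pow_right₀ one_le_two h
    rw [cutoffFun_eq_one, one_mul]
    rw [pow_succ] at h2
    nlinarith

theorem one_sub_cutoffFun_mul_le (n : ℕ) {r : ℝ} (hr : 0 ≤ r) :
    |(1 - cutoffFun n r) * r| ≤ 2 * (1 / 2) ^ n := by
  have h1 := cutoffFun_le_one n r
  have h0 := cutoffFun_nonneg n r
  have hp : (0 : ℝ) < 2 ^ n := by positivity
  rw [abs_of_nonneg (mul_nonneg (by linarith) hr), one_div, inv_pow, ← div_eq_mul_inv,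
    le_div_iff₀ hp]
  rcases le_or_gt 2 (2 ^ n * r) with h2 | h2
  · rw [cutoffFun_eq_one h2]; simp
  · nlinarith [mul_nonneg h0 (mul_nonneg hp.le hr)]

/-- The quotient `cutoffFun n r / r`. -/
noncomputable def cutoffQuot (n : ℕ) (r : ℝ) : ℝ := cutoffFun n r / max r ((2 ^ n)⁻¹)

theorem continuous_cutoffQuot (n : ℕ) : Continuous (cutoffQuot n) := by
  refine (continuous_cutoffFun n).div (by fun_prop) fun r => ?_
  have : (0 : ℝ) < (2 ^ n)⁻¹ := by positivity
  exact (this.trans_le (le_max_right _ _)).ne'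

/-- The maximum alters the denominator only where the cutoff vanishes; it serves to keep the
quotient continuous. -/
theorem mul_cutoffQuot (n : ℕ) (r : ℝ) : r * cutoffQuot n r = cutoffFun n r := by
  have hp : (0 : ℝ) < 2 ^ n := by positivity
  rcases le_or_gt (2 ^ n * r) 1 with h | h
  · rw [cutoffQuot, cutoffFun_eq_zero h]; simp
  · have hr : (2 ^ n)⁻¹ < r := by rwa [inv_lt_iff_one_lt_mul₀ hp, mul_comm]
    have hr0 : 0 < r := (inv_pos.2 hp).trans hr
    rw [cutoffQuot, max_eq_left hr.le, mul_div_cancel₀ _ hr0.ne']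

/-- Large spectral values of `A` correspond to values of `R` near `0`, so the cutoffs are functions
`χₙ(R)` vanishing near `0`. Writing `χₙ(R) = R (χₙ/r)(R)` gives the bounded operator `Λ χₙ(R) = T
(χₙ/r)(R)`. Strong convergence holds on the dense range of `R`, and extends because `‖χₙ(R)‖ ≤ 1`.
-/
theorem IsNonnegSqrt.nonempty_spectralCutoff {A L : H →ₗ.[ℂ] H} (hL : IsNonnegSqrt A L)
    (hA : IsSelfAdjoint A) (hA0 : IsNonneg A) : Nonempty (SpectralCutoff L) := by
  obtain ⟨R, h⟩ := exists_isResolvent hA hA0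
  obtain ⟨T, hT, hRT, hgraph⟩ := hL.exists_sqrt_mul_resolvent h
  have hR := h.isSelfAdjoint
  have hc := continuous_cutoffFun
  have hq := continuous_cutoffQuot
  have hfac : ∀ n, cfc (cutoffFun n) R = R * cfc (cutoffQuot n) R := fun n => by
    have e := cfc_mul (fun r : ℝ => r) (cutoffQuot n) R continuousOn_id (hq n).continuousOn
    rw [cfc_id' ℝ R] at e
    rw [← e]
    exact cfc_congr fun r _ => (mul_cutoffQuot n r).symm
  have hnorm : ∀ n x, ‖cfc (cutoffFun n) R x‖ ≤ ‖x‖ := fun n x => by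
    have : ‖cfc (cutoffFun n) R‖ ≤ 1 := norm_cfc_le zero_le_one fun r _ => by
      rw [Real.norm_of_nonneg (cutoffFun_nonneg n r)]
      exact cutoffFun_le_one n r
    simpa using (cfc (cutoffFun n) R).le_of_opNorm_le this x
  have hres : ∀ n x, ‖R x - cfc (cutoffFun n) R (R x)‖ ≤ 2 * (1 / 2) ^ n * ‖x‖ := fun n x => by
    have e : R - cfc (cutoffFun n) R * R = cfc (fun r => (1 - cutoffFun n r) * r) R := by
      rw [cfc_mul (fun r => 1 - cutoffFun n r) (fun r => r) R
        (continuous_const.sub (hc n)).continuousOn continuousOn_id,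
        cfc_sub _ _ R continuousOn_const (hc n).continuousOn, cfc_const_one ℝ R, cfc_id' ℝ R,
        sub_mul, one_mul]
    have : ‖R - cfc (cutoffFun n) R * R‖ ≤ 2 * (1 / 2) ^ n := by
      rw [e]
      exact norm_cfc_le (by positivity) fun r hr =>
        one_sub_cutoffFun_mul_le n (h.spectrum_subset hr).1
    exact ContinuousLinearMap.le_of_opNorm_le _ this x
  refine ⟨fun n => cfc (cutoffFun n) R, fun n => T * cfc (cutoffQuot n) R,
    fun n => cfc_predicate _ _, fun n => ?_, fun x => ?_, fun n x => ?_, fun {n m} hnm => ?_⟩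
  · exact (hT.commute_iff (cfc_predicate _ _)).1 (hRT.cfc_real _).symm
  · rw [Metric.tendsto_atTop]
    intro ε hε
    obtain ⟨y, hy⟩ := (h.denseRange hA).exists_dist_lt x (by positivity : 0 < ε / 3)
    rw [dist_eq_norm] at hy
    have hlim : Tendsto (fun n : ℕ => 2 * (1 / 2 : ℝ) ^ n * ‖y‖) atTop (𝓝 0) := by
      simpa using ((tendsto_pow_atTop_nhds_zero_of_lt_one (by norm_num : (0 : ℝ) ≤ 1 / 2)
        (by norm_num)).const_mul 2).mul_const ‖y‖
    obtain ⟨N, hN⟩ := eventually_atTop.1 (hlim.eventually (gt_mem_nhds (by positivity : 0 < ε / 3)))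
    refine ⟨N, fun n hn => ?_⟩
    rw [dist_eq_norm]
    have e : cfc (cutoffFun n) R x - x =
        cfc (cutoffFun n) R (x - R y) - (R y - cfc (cutoffFun n) R (R y)) - (x - R y) := by
      rw [map_sub]; abel
    rw [e]
    have h1 := norm_sub_le (cfc (cutoffFun n) R (x - R y) - (R y - cfc (cutoffFun n) R (R y)))
      (x - R y)
    have h2 := norm_sub_le (cfc (cutoffFun n) R (x - R y)) (R y - cfc (cutoffFun n) R (R y))
    linarith [hnorm n (x - R y), hres n y, hN n hn]
  · have h1 := hgraph (cfc (cutoffQuot n) R x)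
    have h2 : cfc (cutoffFun n) R x = R (cfc (cutoffQuot n) R x) :=
      DFunLike.congr_fun (hfac n) x
    rw [h2]
    exact h1
  · rw [← cfc_mul _ _ R (hc m).continuousOn (hc n).continuousOn]
    exact cfc_congr fun r _ => cutoffFun_mul_cutoffFun hnm r

end Operators

/-! ### Operators on `H × H`. -/

section Product

theorem prod_ext {H : Type*} {x y : WithLp 2 (H × H)} (h1 : x.fst = y.fst)
    (h2 : x.snd = y.snd) : x = y :=
  (WithLp.ofLp_injective 2) (Prod.ext h1 h2)

variable {H : Type*} [NormedAddCommGroup H] [InnerProductSpace ℂ H]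

/-- The operator `(p, q) ↦ (a p, a q)` in `H × H`. -/
noncomputable def diagOp (a : H →L[ℂ] H) : WithLp 2 (H × H) →L[ℂ] WithLp 2 (H × H) :=
  (WithLp.prodContinuousLinearEquiv 2 ℂ H H).symm.toContinuousLinearMap ∘L
    (a.prodMap a) ∘L (WithLp.prodContinuousLinearEquiv 2 ℂ H H).toContinuousLinearMap

/-- The operator `(p, q) ↦ (l q, -l p)` in `H × H`. -/
noncomputable def skewOp (l : H →L[ℂ] H) : WithLp 2 (H × H) →L[ℂ] WithLp 2 (H × H) :=
  (WithLp.prodContinuousLinearEquiv 2 ℂ H H).symm.toContinuousLinearMap ∘L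
    ((l ∘L ContinuousLinearMap.snd ℂ H H).prod (-(l ∘L ContinuousLinearMap.fst ℂ H H))) ∘L
      (WithLp.prodContinuousLinearEquiv 2 ℂ H H).toContinuousLinearMap

variable (H) in
/-- The projection `(p, q) ↦ (0, q)` in `H × H`. -/
noncomputable def projSnd : WithLp 2 (H × H) →L[ℂ] WithLp 2 (H × H) :=
  (WithLp.prodContinuousLinearEquiv 2 ℂ H H).symm.toContinuousLinearMap ∘L
    ((0 : H × H →L[ℂ] H).prod (ContinuousLinearMap.snd ℂ H H)) ∘L
      (WithLp.prodContinuousLinearEquiv 2 ℂ H H).toContinuousLinearMap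

variable (H) in
/-- The time reversal `(p, q) ↦ (p, -q)` in `H × H`. -/
noncomputable def reflectOp : WithLp 2 (H × H) →L[ℂ] WithLp 2 (H × H) :=
  (WithLp.prodContinuousLinearEquiv 2 ℂ H H).symm.toContinuousLinearMap ∘L
    ((ContinuousLinearMap.fst ℂ H H).prod (-ContinuousLinearMap.snd ℂ H H)) ∘L
      (WithLp.prodContinuousLinearEquiv 2 ℂ H H).toContinuousLinearMap

@[simp] theorem diagOp_fst (a : H →L[ℂ] H) (x : WithLp 2 (H × H)) :
    (diagOp a x).fst = a x.fst := rfl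
@[simp] theorem diagOp_snd (a : H →L[ℂ] H) (x : WithLp 2 (H × H)) :
    (diagOp a x).snd = a x.snd := rfl
@[simp] theorem projSnd_fst (x : WithLp 2 (H × H)) : (projSnd H x).fst = 0 := rfl
@[simp] theorem projSnd_snd (x : WithLp 2 (H × H)) : (projSnd H x).snd = x.snd := rfl

theorem norm_projSnd_le : ‖projSnd H‖ ≤ 1 := by
  refine ContinuousLinearMap.opNorm_le_bound _ zero_le_one fun x => ?_
  rw [one_mul]
  refine abs_le_of_sq_le_sq' ?_ (norm_nonneg _) |>.2
  rw [WithLp.prod_norm_sq_eq_of_L2, WithLp.prod_norm_sq_eq_of_L2]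
  simp

theorem continuous_prod_fst : Continuous fun x : WithLp 2 (H × H) => x.fst :=
  continuous_fst.comp (WithLp.prodContinuousLinearEquiv 2 ℂ H H).continuous

theorem continuous_prod_snd : Continuous fun x : WithLp 2 (H × H) => x.snd :=
  continuous_snd.comp (WithLp.prodContinuousLinearEquiv 2 ℂ H H).continuous

theorem intervalIntegral_prod_fst [CompleteSpace H] {f : ℝ → WithLp 2 (H × H)} {a b : ℝ}
    (hf : IntervalIntegrable f volume a b) : (∫ s in a..b, f s).fst = ∫ s in a..b, (f s).fst :=
  (ContinuousLinearMap.intervalIntegral_comp_comm (ContinuousLinearMap.fst ℂ H H ∘L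
    (WithLp.prodContinuousLinearEquiv 2 ℂ H H).toContinuousLinearMap) hf).symm

theorem intervalIntegral_prod_snd [CompleteSpace H] {f : ℝ → WithLp 2 (H × H)} {a b : ℝ}
    (hf : IntervalIntegrable f volume a b) : (∫ s in a..b, f s).snd = ∫ s in a..b, (f s).snd :=
  (ContinuousLinearMap.intervalIntegral_comp_comm (ContinuousLinearMap.snd ℂ H H ∘L
    (WithLp.prodContinuousLinearEquiv 2 ℂ H H).toContinuousLinearMap) hf).symm

theorem skewOp_mem_skewAdjoint [CompleteSpace H] {l : H →L[ℂ] H} (hl : IsSelfAdjoint l) :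
    skewOp l ∈ skewAdjoint (WithLp 2 (H × H) →L[ℂ] WithLp 2 (H × H)) := by
  rw [skewAdjoint.mem_iff, ContinuousLinearMap.star_eq_adjoint]
  refine ((ContinuousLinearMap.eq_adjoint_iff _ _).2 fun x y => ?_).symm
  have h : ∀ x y, ⟪l x, y⟫_ℂ = ⟪x, l y⟫_ℂ := fun x y => hl.isSymmetric x y
  rw [_root_.neg_apply, inner_neg_left, WithLp.prod_inner_apply, WithLp.prod_inner_apply]
  change -(⟪l x.snd, y.fst⟫_ℂ + ⟪-l x.fst, y.snd⟫_ℂ) =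
    ⟪x.fst, l y.snd⟫_ℂ + ⟪x.snd, -l y.fst⟫_ℂ
  rw [inner_neg_left, inner_neg_right, h, h]
  ring

end Product

/-! ### Finite-energy solutions and weak solutions in `H × H`. -/

section Link

variable {H : Type*} [NormedAddCommGroup H] [InnerProductSpace ℂ H] [CompleteSpace H]

namespace SpectralCutoff

variable {L : H →ₗ.[ℂ] H} (c : SpectralCutoff L)

theorem lam_mul_cut {n m : ℕ} (h : n < m) : c.lam m * c.cut n = c.lam n := by
  ext x
  exact L.mem_graph_snd_inj (c.mem_graph m (c.cut n x)) (c.mem_graph n x)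
    (DFunLike.congr_fun (c.cut_mul_cut h) x)

theorem cut_mul_lam {n m : ℕ} (h : n < m) : c.cut n * c.lam m = c.lam n := by
  have := congrArg star (c.lam_mul_cut h)
  rwa [star_mul, (c.cut_selfAdjoint n).star_eq, (c.lam_selfAdjoint m).star_eq,
    (c.lam_selfAdjoint n).star_eq] at this

theorem cut_lam {n m : ℕ} (h : n < m) (x : H) : c.cut m (c.lam n x) = c.lam n x := by
  have h1 : c.cut m * c.lam n = c.lam n := by
    rw [← c.cut_mul_lam n.lt_succ_self, ← mul_assoc, c.cut_mul_cut h]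
  exact DFunLike.congr_fun h1 x

theorem inner_cut (n : ℕ) (x y : H) : ⟪c.cut n x, y⟫_ℂ = ⟪x, c.cut n y⟫_ℂ :=
  (c.cut_selfAdjoint n).isSymmetric x y

theorem inner_lam (n : ℕ) (x y : H) : ⟪c.lam n x, y⟫_ℂ = ⟪x, c.lam n y⟫_ℂ :=
  (c.lam_selfAdjoint n).isSymmetric x y

/-- Self-adjointness of `L` and of the cutoffs moves `L` across the inner product: on the domain of
`L`, `cut n ∘ L = L ∘ cut n`. -/
theorem cut_eq_lam (hL : IsSelfAdjoint L) (n : ℕ) {x y : H} (h : (x, y) ∈ L.graph) :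
    c.cut n y = c.lam n x := by
  refine ext_inner_left ℂ fun w => ?_
  rw [← inner_cut, ← inner_lam]
  exact ((mem_graph_iff_of_isSelfAdjoint hL _ _).1 h _ _ (c.mem_graph n w)).symm

/-- The cutoffs of the generator `(p, q) ↦ (L q, -L p)` of the free equation. -/
noncomputable def generator : GeneratorCutoff (WithLp 2 (H × H)) where
  cut n := diagOp (c.cut n)
  gen n := skewOp (c.lam n)
  tendsto_cut x := by
    have h := (WithLp.prodContinuousLinearEquiv 2 ℂ H H).symm.continuous.tendsto (x.fst, x.snd)
    exact h.comp ((c.tendsto_cut x.fst).prodMk_nhds (c.tendsto_cut x.snd))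
  gen_mul_cut {n m} h := by
    ext x
    refine prod_ext (DFunLike.congr_fun (c.lam_mul_cut h) x.snd) ?_
    exact congrArg Neg.neg (DFunLike.congr_fun (c.lam_mul_cut h) x.fst)
  cut_mul_gen {n m} h := by
    ext x
    refine prod_ext (DFunLike.congr_fun (c.cut_mul_lam h) x.snd) ?_
    refine (map_neg (c.cut n) _).trans ?_
    exact congrArg Neg.neg (DFunLike.congr_fun (c.cut_mul_lam h) x.fst)
  gen_skew n := skewOp_mem_skewAdjoint (c.lam_selfAdjoint n)

theorem reflectOp_flow (t : ℝ) (x : WithLp 2 (H × H)) :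
    reflectOp H (c.generator.flow.op t x) = c.generator.flow.op (-t) (reflectOp H x) := by
  refine c.generator.reflect_flow (fun n => ?_) t x
  ext y
  refine prod_ext ?_ rfl
  change c.lam n y.snd = -(c.lam n (-y.snd))
  rw [map_neg, neg_neg]

variable {c} {b : ℝ → ℝ} {U : ℝ → WithLp 2 (H × H)}

theorem isWeak_iff (hbI : IntegrableOn b (Ici 0)) (hU : ContinuousOn U (Ici 0)) :
    c.generator.IsWeak (projSnd H) b U ↔ ∀ n, ∀ t ∈ Ici (0 : ℝ),
      c.cut n (U t).fst = c.cut n (U 0).fst + c.lam n (∫ s in (0 : ℝ)..t, (U s).snd) ∧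
      c.cut n ((U t).snd - (U 0).snd + ∫ s in (0 : ℝ)..t, ((2 * b s : ℝ) : ℂ) • (U s).snd) +
        c.lam n (∫ s in (0 : ℝ)..t, (U s).fst) = 0 := by
  have key : ∀ n, ∀ t ∈ Ici (0 : ℝ), ∫ s in (0 : ℝ)..t,
      (skewOp (c.lam n) (U s) - ((2 * b s : ℝ) : ℂ) • diagOp (c.cut n) (projSnd H (U s))) =
      skewOp (c.lam n) (∫ s in (0 : ℝ)..t, U s) -
        diagOp (c.cut n) (projSnd H (∫ s in (0 : ℝ)..t, ((2 * b s : ℝ) : ℂ) • U s)) := by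
    intro n t ht
    have h1 : IntervalIntegrable U volume 0 t :=
      (continuousOn_uIcc_of_Ici hU ht).intervalIntegrable
    have h2 := intervalIntegrable_weight_smul hbI hU ht
    have h3 : IntervalIntegrable (fun s => skewOp (c.lam n) (U s)) volume 0 t :=
      ((skewOp (c.lam n)).continuous.comp_continuousOn
        (continuousOn_uIcc_of_Ici hU ht)).intervalIntegrable
    have h4 := intervalIntegrable_weight_smul hbI
      ((diagOp (c.cut n) ∘L projSnd H).continuous.comp_continuousOn hU) ht
    refine (intervalIntegral.integral_sub h3 h4).trans ?_
    rw [ContinuousLinearMap.intervalIntegral_comp_comm _ h1]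
    congr 1
    refine Eq.trans ?_ (ContinuousLinearMap.intervalIntegral_comp_comm
      (diagOp (c.cut n) ∘L projSnd H) h2)
    simp only [map_smul]
    rfl
  have hfst : ∀ t ∈ Ici (0 : ℝ), (∫ s in (0 : ℝ)..t, U s).fst = ∫ s in (0 : ℝ)..t, (U s).fst :=
    fun t ht => intervalIntegral_prod_fst (continuousOn_uIcc_of_Ici hU ht).intervalIntegrable
  have hsnd : ∀ t ∈ Ici (0 : ℝ), (∫ s in (0 : ℝ)..t, U s).snd = ∫ s in (0 : ℝ)..t, (U s).snd :=
    fun t ht => intervalIntegral_prod_snd (continuousOn_uIcc_of_Ici hU ht).intervalIntegrable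
  have hsnd' : ∀ t ∈ Ici (0 : ℝ), (∫ s in (0 : ℝ)..t, ((2 * b s : ℝ) : ℂ) • U s).snd =
      ∫ s in (0 : ℝ)..t, ((2 * b s : ℝ) : ℂ) • (U s).snd := fun t ht =>
    intervalIntegral_prod_snd (intervalIntegrable_weight_smul hbI hU ht)
  have hiff : ∀ n, ∀ t ∈ Ici (0 : ℝ),
      (diagOp (c.cut n) (U t) = diagOp (c.cut n) (U 0) + ∫ s in (0 : ℝ)..t,
        (skewOp (c.lam n) (U s) - ((2 * b s : ℝ) : ℂ) • diagOp (c.cut n) (projSnd H (U s)))) ↔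
      (c.cut n (U t).fst = c.cut n (U 0).fst + c.lam n (∫ s in (0 : ℝ)..t, (U s).snd) ∧
      c.cut n ((U t).snd - (U 0).snd + ∫ s in (0 : ℝ)..t, ((2 * b s : ℝ) : ℂ) • (U s).snd) +
        c.lam n (∫ s in (0 : ℝ)..t, (U s).fst) = 0) := by
    intro n t ht
    rw [key n t ht, ← hfst t ht, ← hsnd t ht, ← hsnd' t ht]
    set I := ∫ s in (0 : ℝ)..t, U s
    set J := ∫ s in (0 : ℝ)..t, ((2 * b s : ℝ) : ℂ) • U s
    have e1 : (diagOp (c.cut n) (U 0) + (skewOp (c.lam n) I -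
        diagOp (c.cut n) (projSnd H J))).fst = c.cut n (U 0).fst + c.lam n I.snd := by
      change c.cut n (U 0).fst + (c.lam n I.snd - c.cut n 0) = _
      rw [map_zero, sub_zero]
    have e2 : (diagOp (c.cut n) (U 0) + (skewOp (c.lam n) I -
        diagOp (c.cut n) (projSnd H J))).snd =
        c.cut n (U 0).snd + (-c.lam n I.fst - c.cut n J.snd) := rfl
    rw [map_add, map_sub]
    constructor
    · intro h
      refine ⟨by rw [← e1, ← h, diagOp_fst], ?_⟩
      have h2 := congrArg WithLp.snd h
      rw [e2, diagOp_snd] at h2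
      rw [h2]; abel
    · rintro ⟨h1, h2⟩
      refine prod_ext (by rw [e1, ← h1, diagOp_fst]) ?_
      rw [e2, diagOp_snd, ← sub_eq_zero, ← h2]
      abel
  exact ⟨fun h n t ht => (hiff n t ht).1 (h.eq n t ht),
    fun h => ⟨hU, fun n t ht => (hiff n t ht).2 (h n t ht)⟩⟩

end SpectralCutoff

variable {A : H →ₗ.[ℂ] H} {b : ℝ → ℝ}

theorem inner_intervalIntegral (φ : H) {f : ℝ → H} {a t : ℝ}
    (hf : IntervalIntegrable f volume a t) :
    ∫ s in a..t, ⟪φ, f s⟫_ℂ = ⟪φ, ∫ s in a..t, f s⟫_ℂ :=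
  ContinuousLinearMap.intervalIntegral_comp_comm (innerSL ℂ φ) hf

theorem continuousOn_toProd {u : ℝ → (sqrtOp A).domain} {u' : ℝ → H}
    (h1 : ContinuousOn (fun t => sqrtOp A (u t)) (Ici 0)) (h2 : ContinuousOn u' (Ici 0)) :
    ContinuousOn (fun t => Data.toProd A (Data.mk (u t) (u' t))) (Ici 0) :=
  (WithLp.prodContinuousLinearEquiv 2 ℂ H H).symm.continuous.comp_continuousOn (h1.prodMk h2)

theorem integral_equation_eq (hbI : IntegrableOn b (Ici 0)) {f g : ℝ → H}
    (hf : ContinuousOn f (Ici 0)) (hg : ContinuousOn g (Ici 0)) (φ ψ : H) {t : ℝ} (ht : 0 ≤ t) :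
    ⟪φ, f t⟫_ℂ - ⟪φ, f 0⟫_ℂ + (∫ s in (0 : ℝ)..t,
      (((2 * b s : ℝ) : ℂ) * ⟪φ, f s⟫_ℂ + ⟪ψ, g s⟫_ℂ)) =
    ⟪φ, f t - f 0 + ∫ s in (0 : ℝ)..t, ((2 * b s : ℝ) : ℂ) • f s⟫_ℂ +
      ⟪ψ, ∫ s in (0 : ℝ)..t, g s⟫_ℂ := by
  have h1 := intervalIntegrable_weight_smul hbI hf ht
  have h2 := intervalIntegrable_weight_smul hbI
    ((innerSL ℂ φ).continuous.comp_continuousOn hf) ht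
  have h3 : IntervalIntegrable g volume 0 t := (continuousOn_uIcc_of_Ici hg ht).intervalIntegrable
  have h4 : IntervalIntegrable (fun s => ⟪ψ, g s⟫_ℂ) volume 0 t :=
    ((innerSL ℂ ψ).continuous.comp_continuousOn (continuousOn_uIcc_of_Ici hg ht)).intervalIntegrable
  have h5 : ∫ s in (0 : ℝ)..t, ((2 * b s : ℝ) : ℂ) * ⟪φ, f s⟫_ℂ =
      ⟪φ, ∫ s in (0 : ℝ)..t, ((2 * b s : ℝ) : ℂ) • f s⟫_ℂ := by
    rw [← inner_intervalIntegral φ h1]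
    simp only [inner_smul_right]
  have h6 := intervalIntegral.integral_add h2 h4
  simp only [Function.comp_apply, smul_eq_mul, innerSL_apply_apply] at h6
  rw [h6, h5, inner_intervalIntegral ψ h3, inner_add_right, inner_sub_right]
  ring

theorem IsFiniteEnergySolution.continuousOn {u : ℝ → (sqrtOp A).domain} {u' : ℝ → H}
    (h : IsFiniteEnergySolution A b u u') : ContinuousOn (fun t => (u t : H)) (Ici 0) :=
  fun t ht => (h.hasDeriv t ht).continuousWithinAt

theorem IsFiniteEnergySolution.eq_integral {u : ℝ → (sqrtOp A).domain} {u' : ℝ → H}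
    (h : IsFiniteEnergySolution A b u u') {t : ℝ} (ht : 0 ≤ t) :
    (u t : H) = u 0 + ∫ s in (0 : ℝ)..t, u' s := by
  have h1 := intervalIntegral.integral_eq_sub_of_hasDeriv_right
    (continuousOn_uIcc_of_Ici h.continuousOn ht) (f' := u') (fun x hx => by
      rw [min_eq_left ht] at hx
      exact (h.hasDeriv x hx.1.le).mono fun y hy => hx.1.le.trans (le_of_lt hy))
    (continuousOn_uIcc_of_Ici h.continuousOn_deriv ht).intervalIntegrable
  rw [h1, add_sub_cancel]

theorem IsFiniteEnergySolution.isWeak (hL : IsNonnegSqrt A (sqrtOp A))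
    (c : SpectralCutoff (sqrtOp A)) (hbI : IntegrableOn b (Ici 0))
    {u : ℝ → (sqrtOp A).domain} {u' : ℝ → H} (h : IsFiniteEnergySolution A b u u') :
    c.generator.IsWeak (projSnd H) b (fun t => Data.toProd A (Data.mk (u t) (u' t))) := by
  rw [SpectralCutoff.isWeak_iff hbI (continuousOn_toProd h.continuousOn_sqrt h.continuousOn_deriv)]
  intro n t ht
  change c.cut n (sqrtOp A (u t)) = c.cut n (sqrtOp A (u 0)) +
      c.lam n (∫ s in (0 : ℝ)..t, u' s) ∧
    c.cut n (u' t - u' 0 + ∫ s in (0 : ℝ)..t, ((2 * b s : ℝ) : ℂ) • u' s) +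
      c.lam n (∫ s in (0 : ℝ)..t, sqrtOp A (u s)) = 0
  have hcl : ∀ t, c.cut n (sqrtOp A (u t)) = c.lam n (u t) := fun t =>
    c.cut_eq_lam hL.selfAdjoint n ((sqrtOp A).mem_graph (u t))
  refine ⟨by rw [hcl, hcl, h.eq_integral ht, map_add], ?_⟩
  refine ext_inner_left ℂ fun ψ => ?_
  -- The test element is `φ = cut n ψ`. It lies in `D(A)` because `Λφ = lam n ψ` is fixed by `cut (n
  -- + 1)` and so lies in `D(Λ)`.
  have hz : (c.lam n ψ, c.lam (n + 1) (c.lam n ψ)) ∈ (sqrtOp A).graph := by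
    have := c.mem_graph (n + 1) (c.lam n ψ)
    rwa [c.cut_lam n.lt_succ_self] at this
  obtain ⟨φ, hφ1, hφ2⟩ := (LinearPMap.mem_graph_iff A).1
    ((hL.sq _ _).2 ⟨_, c.mem_graph n ψ, hz⟩)
  have heq := h.equation φ t ht
  rw [integral_equation_eq hbI h.continuousOn_deriv h.continuousOn _ _ ht] at heq
  have hp : IntervalIntegrable (fun s => sqrtOp A (u s)) volume 0 t :=
    (continuousOn_uIcc_of_Ici h.continuousOn_sqrt ht).intervalIntegrable
  have hu : IntervalIntegrable (fun s => (u s : H)) volume 0 t :=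
    (continuousOn_uIcc_of_Ici h.continuousOn ht).intervalIntegrable
  have h2 : ⟪A φ, ∫ s in (0 : ℝ)..t, (u s : H)⟫_ℂ =
      ⟪c.lam n ψ, ∫ s in (0 : ℝ)..t, sqrtOp A (u s)⟫_ℂ := by
    rw [← inner_intervalIntegral _ hu, ← inner_intervalIntegral _ hp]
    refine intervalIntegral.integral_congr fun s _ => ?_
    have hφ2' : A φ = c.lam (n + 1) (c.lam n ψ) := hφ2
    rw [hφ2']
    exact (mem_graph_iff_of_isSelfAdjoint hL.selfAdjoint _ _).1
      ((sqrtOp A).mem_graph (u s)) _ _ hz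
  have hφ1' : (φ : H) = c.cut n ψ := hφ1
  rw [inner_add_right, inner_zero_right, ← c.inner_cut, ← c.inner_lam, ← h2, ← hφ1', heq]

theorem exists_isFiniteEnergySolution_of_isWeak (hL : IsNonnegSqrt A (sqrtOp A))
    (c : SpectralCutoff (sqrtOp A)) (hbI : IntegrableOn b (Ici 0))
    {U : ℝ → WithLp 2 (H × H)} (hU : c.generator.IsWeak (projSnd H) b U)
    {u₁ : (sqrtOp A).domain} {u₂ : H} (h0 : U 0 = Data.toProd A (Data.mk u₁ u₂)) :
    ∃ u u', IsFiniteEnergySolution A b u u' ∧ u 0 = u₁ ∧ u' 0 = u₂ ∧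
      ∀ t ∈ Ici (0 : ℝ), U t = Data.toProd A (Data.mk (u t) (u' t)) := by
  have hUc := hU.continuousOn
  rw [SpectralCutoff.isWeak_iff hbI hUc] at hU
  have hqc : ContinuousOn (fun t => (U t).snd) (Ici 0) :=
    continuous_prod_snd.comp_continuousOn hUc
  have hpc : ContinuousOn (fun t => (U t).fst) (Ici 0) :=
    continuous_prod_fst.comp_continuousOn hUc
  -- The first component of `U` only records `Λu`, so `u` itself is rebuilt by integrating the
  -- velocity from `u₁`.
  set v : ℝ → H := fun t => u₁ + ∫ s in (0 : ℝ)..t, (U s).snd with hv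
  have hp0 : (U 0).fst = sqrtOp A u₁ := by rw [h0]; rfl
  have hq0 : (U 0).snd = u₂ := by rw [h0]; rfl
  have hgraph : ∀ t ∈ Ici (0 : ℝ), (v t, (U t).fst) ∈ (sqrtOp A).graph := fun t ht => by
    have hcl : ∀ n, c.cut n (U t).fst = c.lam n (v t) := fun n => by
      rw [(hU n t ht).1, hp0, c.cut_eq_lam hL.selfAdjoint n ((sqrtOp A).mem_graph u₁), hv,
        map_add]
    -- Closedness of the graph of `Λ` gives both `v t ∈ D(Λ)` and `Λ v t = (U t).fst`.
    have hlim : Tendsto (fun n => (c.cut n (v t), c.lam n (v t))) atTop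
        (𝓝 (v t, (U t).fst)) := by
      refine (c.tendsto_cut _).prodMk_nhds ?_
      simp_rw [← hcl]
      exact c.tendsto_cut _
    exact (hL.selfAdjoint.isClosed).mem_of_tendsto hlim
      (Eventually.of_forall fun n => c.mem_graph n (v t))
  have hdom : ∀ t, v (max t 0) ∈ (sqrtOp A).domain := fun t =>
    LinearPMap.mem_domain_of_mem_graph (hgraph _ (le_max_right t 0))
  -- Values in the domain are required at every real time; `max t 0` freezes `v` at negative times.
  set u : ℝ → (sqrtOp A).domain := fun t => ⟨v (max t 0), hdom t⟩ with hu
  have huv : ∀ t ∈ Ici (0 : ℝ), (u t : H) = v t := fun t ht => by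
    simp only [hu]; rw [max_eq_left ht]
  have hLu : ∀ t ∈ Ici (0 : ℝ), sqrtOp A (u t) = (U t).fst := fun t ht => by
    have h1 := (sqrtOp A).mem_graph (u t)
    exact (sqrtOp A).mem_graph_snd_inj h1 (hgraph t ht) (huv t ht)
  have hderiv : ∀ t ∈ Ici (0 : ℝ), HasDerivWithinAt (fun s => (u s : H)) (U t).snd (Ici 0) t := by
    intro t ht
    have hqc' : Continuous fun s => (U (max s 0)).snd :=
      hqc.comp_continuous (continuous_id.max continuous_const) fun s => le_max_right s 0
    have h1 := ((intervalIntegral.integral_hasDerivAt_right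
      (hqc'.intervalIntegrable 0 t) (hqc'.stronglyMeasurableAtFilter _ _)
      hqc'.continuousAt).const_add (u₁ : H)).hasDerivWithinAt (s := Ici 0)
    rw [max_eq_left ht] at h1
    have h2 : ∀ s ∈ Ici (0 : ℝ), (u s : H) = u₁ + ∫ r in (0 : ℝ)..s, (U (max r 0)).snd := by
      intro s hs
      refine (huv s hs).trans (congrArg (fun w : H => (u₁ : H) + w)
        (intervalIntegral.integral_congr fun r hr => ?_))
      rw [uIcc_of_le hs] at hr
      rw [max_eq_left hr.1]
    exact h1.congr h2 (h2 t ht)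
  refine ⟨u, fun t => (U t).snd, ⟨hpc.congr hLu, hderiv, hqc, fun φ t ht => ?_⟩, ?_, hq0,
    fun t ht => ?_⟩
  · have huc : ContinuousOn (fun t => (u t : H)) (Ici 0) := fun t ht =>
      (hderiv t ht).continuousWithinAt
    rw [integral_equation_eq hbI hqc huc _ _ ht]
    set V := (U t).snd - (U 0).snd + ∫ s in (0 : ℝ)..t, ((2 * b s : ℝ) : ℂ) • (U s).snd
    obtain ⟨z, hz1, hz2⟩ := (hL.sq _ _).1 (A.mem_graph φ)
    have hp : IntervalIntegrable (fun s => (U s).fst) volume 0 t :=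
      (continuousOn_uIcc_of_Ici hpc ht).intervalIntegrable
    have hui : IntervalIntegrable (fun s => (u s : H)) volume 0 t :=
      (continuousOn_uIcc_of_Ici huc ht).intervalIntegrable
    -- The weak equation holds only after a cutoff, so the test element is cut off first and the
    -- cutoff is then removed in the limit.
    have hn : ∀ n, ⟪c.cut n (φ : H), V⟫_ℂ +
        ⟪c.cut n (A φ), ∫ s in (0 : ℝ)..t, (u s : H)⟫_ℂ = 0 := fun n => by
      have h1 : ⟪c.cut n (A φ), ∫ s in (0 : ℝ)..t, (u s : H)⟫_ℂ =
          ⟪c.lam n (φ : H), ∫ s in (0 : ℝ)..t, (U s).fst⟫_ℂ := by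
        rw [← inner_intervalIntegral _ hui, ← inner_intervalIntegral _ hp]
        refine intervalIntegral.integral_congr fun s hs => ?_
        rw [uIcc_of_le ht] at hs
        have h2 := c.cut_eq_lam hL.selfAdjoint n ((sqrtOp A).mem_graph (u s))
        rw [hLu s hs.1] at h2
        rw [c.cut_eq_lam hL.selfAdjoint n hz2, ← c.cut_eq_lam hL.selfAdjoint n hz1, c.inner_lam,
          ← h2, c.inner_cut]
      rw [h1, c.inner_cut, c.inner_lam, ← inner_add_right, (hU n t ht).2, inner_zero_right]
    have hlim : Tendsto (fun n => ⟪c.cut n (φ : H), V⟫_ℂ +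
        ⟪c.cut n (A φ), ∫ s in (0 : ℝ)..t, (u s : H)⟫_ℂ) atTop
        (𝓝 (⟪(φ : H), V⟫_ℂ + ⟪A φ, ∫ s in (0 : ℝ)..t, (u s : H)⟫_ℂ)) :=
      ((c.tendsto_cut _).inner tendsto_const_nhds).add
        ((c.tendsto_cut _).inner tendsto_const_nhds)
    exact tendsto_nhds_unique hlim (tendsto_const_nhds.congr fun n => (hn n).symm)
  · refine Subtype.ext ?_
    rw [huv 0 self_mem_Ici, hv]
    simp
  · exact prod_ext (hLu t ht).symm rfl

end Link

/-! ### Restriction of the evolution to the energy space. -/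

section Energy

variable {H : Type*} [NormedAddCommGroup H] [InnerProductSpace ℂ H] [CompleteSpace H]

/-- The isometric embedding of the energy space into `H × H`, extending `(u₁, u₂) ↦ (Λ u₁, u₂)`. -/
theorem exists_energyEmbedding (A : H →ₗ.[ℂ] H) :
    ∃ ι : EnergySpace A →ₗᵢ[ℂ] WithLp 2 (H × H), ∀ x y,
      ι (toEnergy A x y) = Data.toProd A (Data.mk x y) := by
  set T : Data A →L[ℂ] WithLp 2 (H × H) :=
    LinearMap.mkContinuous (Data.toProd A) 1 fun d => by rw [one_mul]; exact le_rfl with hT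
  have hd : DenseRange (UniformSpace.Completion.toComplL (𝕜 := ℂ) (E := Data A)) :=
    UniformSpace.Completion.denseRange_coe
  have hu : IsUniformInducing (UniformSpace.Completion.toComplL (𝕜 := ℂ) (E := Data A)) :=
    UniformSpace.Completion.isUniformInducing_coe _
  set f := T.extend (UniformSpace.Completion.toComplL (𝕜 := ℂ) (E := Data A)) with hf
  have hfe : ∀ d : Data A, f (d : EnergySpace A) = Data.toProd A d := fun d =>
    ContinuousLinearMap.extend_eq T hd hu d
  refine ⟨⟨f, fun x => ?_⟩, fun x y => hfe _⟩
  induction x using UniformSpace.Completion.induction_on with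
  | hp => exact isClosed_eq (f.continuous.norm) continuous_norm
  | ih d =>
    rw [UniformSpace.Completion.norm_coe]
    change ‖f d‖ = _
    rw [hfe]
    rfl

/-- Operators on `K` which map a dense set of elements of the range of an isometry into the range
restrict to operators on the domain of the isometry. -/
theorem exists_clm_of_mem_range {E K : Type*} [NormedAddCommGroup E] [NormedSpace ℂ E]
    [CompleteSpace E] [NormedAddCommGroup K] [NormedSpace ℂ K] (ι : E →ₗᵢ[ℂ] K) {s : Set E}
    (hs : Dense s) (T : K →L[ℂ] K) (h : ∀ x ∈ s, T (ι x) ∈ range ι) :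
    ∃ T' : E →L[ℂ] E, ∀ x, ι (T' x) = T (ι x) := by
  have hall : ∀ x, ∃ y, ι y = T (ι x) := fun x => by
    have hc : IsClosed {x | T (ι x) ∈ range ι} :=
      ι.isometry.isClosedEmbedding.isClosed_range.preimage (T.continuous.comp ι.continuous)
    exact hc.closure_subset_iff.2 h (hs x)
  choose f hf using hall
  refine ⟨LinearMap.mkContinuous
    { toFun := f
      map_add' := fun x y => ι.injective (by rw [map_add, hf, hf, hf, map_add, map_add])
      map_smul' := fun c x => ι.injective (by
        rw [RingHom.id_apply, map_smul, hf, hf, map_smul, map_smul]) } ‖T‖ fun x => ?_, hf⟩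
  change ‖f x‖ ≤ _
  rw [← ι.norm_map, hf, ← ι.norm_map x]
  exact T.le_opNorm _

theorem intervalIntegral_linearIsometry {E K : Type*} [NormedAddCommGroup E] [NormedSpace ℂ E]
    [CompleteSpace E] [NormedAddCommGroup K] [NormedSpace ℂ K] [CompleteSpace K]
    (ι : E →ₗᵢ[ℂ] K) (f : ℝ → E) (a b : ℝ) :
    ∫ s in a..b, ι (f s) = ι (∫ s in a..b, f s) := by
  simp only [intervalIntegral, map_sub, LinearIsometry.integral_comp_comm]

theorem isMild_comp_iff {E K : Type*} [NormedAddCommGroup E] [NormedSpace ℂ E]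
    [CompleteSpace E] [NormedAddCommGroup K] [NormedSpace ℂ K] [CompleteSpace K]
    (ι : E →ₗᵢ[ℂ] K) {S : IsometricFlow E} {S' : IsometricFlow K} {P : E →L[ℂ] E} {P' : K →L[ℂ] K}
    (hS : ∀ t x, ι (S.op t x) = S'.op t (ι x)) (hP : ∀ x, ι (P x) = P' (ι x)) {b : ℝ → ℝ} {x : E}
    {U : ℝ → E} : S.IsMild P b x U ↔ S'.IsMild P' b (ι x) (fun t => ι (U t)) := by
  have h : ∀ t, (S.op (-t) (U t) =
      x - ∫ s in (0 : ℝ)..t, ((2 * b s : ℝ) : ℂ) • S.op (-s) (P (U s))) ↔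
      (S'.op (-t) (ι (U t)) =
        ι x - ∫ s in (0 : ℝ)..t, ((2 * b s : ℝ) : ℂ) • S'.op (-s) (P' (ι (U s)))) := fun t => by
    rw [← ι.injective.eq_iff, map_sub, ← intervalIntegral_linearIsometry]
    simp only [map_smul, hS, hP]
  refine ⟨fun hU => ⟨ι.continuous.comp_continuousOn hU.continuousOn,
    fun t ht => (h t).1 (hU.eq t ht)⟩, fun hU => ⟨?_, fun t ht => (h t).2 (hU.eq t ht)⟩⟩
  exact (ι.isometry.isEmbedding.continuousOn_iff).2 hU.continuousOn

/-- The free evolution on the energy space: finite-energy solutions are exactly the mild solutions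
with Cauchy data in `D(Λ) × H`. -/
theorem exists_energyFlow {A : H →ₗ.[ℂ] H} (hA : IsSelfAdjoint A) (hA0 : IsNonneg A) :
    ∃ (S : IsometricFlow (EnergySpace A)) (P : EnergySpace A →L[ℂ] EnergySpace A), ‖P‖ ≤ 1 ∧
      ∀ b : ℝ → ℝ, IntegrableOn b (Ici 0) →
        (∀ u u', IsFiniteEnergySolution A b u u' →
          S.IsMild P b (toEnergy A (u 0) (u' 0)) (fun t => toEnergy A (u t) (u' t))) ∧
        (∀ u₁ u₂ U, S.IsMild P b (toEnergy A u₁ u₂) U →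
          ∃ u u', IsFiniteEnergySolution A b u u' ∧ u 0 = u₁ ∧ u' 0 = u₂ ∧
            ∀ t ∈ Ici (0 : ℝ), U t = toEnergy A (u t) (u' t)) := by
  have hL := isNonnegSqrt_sqrtOp hA hA0
  obtain ⟨c⟩ := hL.nonempty_spectralCutoff hA hA0
  obtain ⟨ι, hι⟩ := exists_energyEmbedding A
  have hdense : Dense (range fun d : (sqrtOp A).domain × H => toEnergy A d.1 d.2) :=
    UniformSpace.Completion.denseRange_coe (α := Data A)
  set F := c.generator.flow with hF
  -- The undamped case of the correspondence shows that the flow preserves `(Λu₁, u₂)`-data for `t ≥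
  -- 0`. Negative times follow below by the reflection `(p, q) ↦ (p, -q)`.
  have hfree : ∀ x y t, 0 ≤ t → ∃ u u', F.op t (Data.toProd A (Data.mk x y)) =
      Data.toProd A (Data.mk u u') := fun x y t ht => by
    have hm : F.IsMild (projSnd H) 0 (F.op 0 (Data.toProd A (Data.mk x y)))
        (fun t => F.op t (Data.toProd A (Data.mk x y))) := by
      rw [F.op_zero]
      exact IsometricFlow.isMild_zero_iff.2 fun t _ => rfl
    have h0 : IntegrableOn (0 : ℝ → ℝ) (Ici 0) := integrableOn_zero
    obtain ⟨u, u', -, -, -, h⟩ := exists_isFiniteEnergySolution_of_isWeak hL c h0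
      (U := fun t => F.op t (Data.toProd A (Data.mk x y))) (GeneratorCutoff.isWeak_of_isMild h0 hm) (u₁ := x) (u₂ := y) (by rw [F.op_zero]; rfl)
    exact ⟨u t, u' t, h t ht⟩
  have hrefl : ∀ u u', reflectOp H (Data.toProd A (Data.mk u u')) =
      Data.toProd A (Data.mk u (-u')) := fun u u' => prod_ext rfl rfl
  have hS : ∀ t, ∃ T : EnergySpace A →L[ℂ] EnergySpace A, ∀ x, ι (T x) = F.op t (ι x) := by
    intro t
    refine exists_clm_of_mem_range ι hdense _ ?_
    rintro _ ⟨⟨x, y⟩, rfl⟩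
    rw [hι]
    rcases le_total 0 t with ht | ht
    · obtain ⟨u, u', h⟩ := hfree x y t ht
      exact ⟨toEnergy A u u', by rw [hι, h]⟩
    · obtain ⟨u, u', h⟩ := hfree x (-y) (-t) (neg_nonneg.2 ht)
      refine ⟨toEnergy A u (-u'), ?_⟩
      rw [hι, ← hrefl, ← h, c.reflectOp_flow, hrefl, neg_neg, neg_neg]
  choose op hop using hS
  obtain ⟨P, hP⟩ : ∃ P : EnergySpace A →L[ℂ] EnergySpace A, ∀ x, ι (P x) = projSnd H (ι x) := by
    refine exists_clm_of_mem_range ι hdense _ ?_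
    rintro _ ⟨⟨x, y⟩, rfl⟩
    refine ⟨toEnergy A 0 y, ?_⟩
    rw [hι, hι]
    exact prod_ext (map_zero (sqrtOp A).toFun) rfl
  set S : IsometricFlow (EnergySpace A) :=
    { op := op
      op_zero := by
        ext x
        exact ι.injective (by rw [hop, F.op_zero]; rfl)
      op_add := fun s t => by
        ext x
        exact ι.injective (by
          rw [hop, F.op_add]
          change F.op s (F.op t (ι x)) = ι (op s (op t x))
          rw [hop, hop])
      norm_op := fun t x => by rw [← ι.norm_map, hop, F.norm_op, ι.norm_map]
      continuous_op := fun x => by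
        refine (ι.isometry.comp_continuous_iff).1 ?_
        simp only [Function.comp_def, hop]
        exact F.continuous_op (ι x) } with hSdef
  have hmild : ∀ {b : ℝ → ℝ} {x U}, S.IsMild P b x U ↔
      F.IsMild (projSnd H) b (ι x) (fun t => ι (U t)) := fun {b x U} =>
    isMild_comp_iff ι (S := S) (fun t x => hop t x) hP
  refine ⟨S, P, ?_, fun b hbI => ⟨fun u u' h => ?_, fun u₁ u₂ U hU => ?_⟩⟩
  · refine ContinuousLinearMap.opNorm_le_bound _ zero_le_one fun x => ?_
    rw [← ι.norm_map, hP, ← ι.norm_map x]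
    exact (projSnd H).le_of_opNorm_le norm_projSnd_le _
  · have h1 := (h.isWeak hL c hbI).isMild hbI
    rw [hmild]
    simp only [hι]
    exact h1
  · have hU' := hmild.1 hU
    have h0 : ι (U 0) = Data.toProd A (Data.mk u₁ u₂) := by rw [hU.initial, hι]
    rw [← hU.initial] at hU'
    obtain ⟨u, u', h, h1, h2, h3⟩ := exists_isFiniteEnergySolution_of_isWeak hL c hbI
      (U := fun t => ι (U t)) (GeneratorCutoff.isWeak_of_isMild hbI hU') h0
    exact ⟨u, u', h, h1, h2, fun t ht => ι.injective ((h3 t ht).trans (hι _ _).symm)⟩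

end Energy

/-! ### Energy-space solutions and well-posedness. -/

section EnergySolution

variable {H : Type*} [NormedAddCommGroup H] [InnerProductSpace ℂ H] [CompleteSpace H]
  {A : H →ₗ.[ℂ] H} {S : IsometricFlow (EnergySpace A)} {P : EnergySpace A →L[ℂ] EnergySpace A}
  {b : ℝ → ℝ}

/-- Solutions in the energy space are exactly the mild solutions. -/
theorem isEnergySolution_iff (hP : ‖P‖ ≤ 1) (hb : ∀ t, 0 ≤ t → 0 ≤ b t)
    (hbI : IntegrableOn b (Ici 0))
    (h1 : ∀ u u', IsFiniteEnergySolution A b u u' →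
      S.IsMild P b (toEnergy A (u 0) (u' 0)) (fun t => toEnergy A (u t) (u' t)))
    (h2 : ∀ u₁ u₂ U, S.IsMild P b (toEnergy A u₁ u₂) U →
      ∃ u u', IsFiniteEnergySolution A b u u' ∧ u 0 = u₁ ∧ u' 0 = u₂ ∧
        ∀ t ∈ Ici (0 : ℝ), U t = toEnergy A (u t) (u' t))
    {x : EnergySpace A} {U : ℝ → EnergySpace A} :
    IsEnergySolution A b x U ↔ S.IsMild P b x U := by
  obtain ⟨C, hC⟩ := IsometricFlow.exists_norm_sub_le (S := S) hP hb hbI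
  constructor
  · rintro ⟨rfl, u, u', hu, hlim⟩
    have hpt : ∀ t, 0 ≤ t → Tendsto (fun n => toEnergy A (u n t) (u' n t)) atTop (𝓝 (U t)) :=
      fun t ht => (hlim t).tendsto_at ⟨ht, le_rfl⟩
    have hsol := IsometricFlow.isMild_sol (S := S) hP hb hbI (U 0)
    -- The approximants have data converging to `U 0`, so continuous dependence makes them converge
    -- to the mild solution with that data.
    have hV : ∀ t ∈ Ici (0 : ℝ), U t = S.op t
        ((S.kernel hP measurableSet_Ici hb hbI).sol (U 0) t) := fun t ht => by
      refine tendsto_nhds_unique (hpt t ht) (tendsto_iff_norm_sub_tendsto_zero.2 ?_)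
      refine squeeze_zero (fun n => norm_nonneg _)
        (fun n => hC _ _ _ _ (h1 _ _ (hu n)) hsol t ht) ?_
      simpa using (tendsto_iff_norm_sub_tendsto_zero.1 (hpt 0 le_rfl)).const_mul C
    refine ⟨hsol.continuousOn.congr hV, fun t ht => ?_⟩
    rw [hV t ht, hsol.eq t ht]
    congr 1
    refine intervalIntegral.integral_congr fun s hs => ?_
    rw [uIcc_of_le ht] at hs
    rw [hV s hs.1]
  · intro hU
    refine ⟨hU.initial, ?_⟩
    have hd : ∀ n : ℕ, ∃ d : (sqrtOp A).domain × H,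
        ‖toEnergy A d.1 d.2 - x‖ < 1 / ((n : ℝ) + 1) := fun n => by
      obtain ⟨d, hd⟩ := (UniformSpace.Completion.denseRange_coe (α := Data A)).exists_dist_lt x
        (Nat.one_div_pos_of_nat (α := ℝ) (n := n))
      rw [dist_comm, dist_eq_norm] at hd
      exact ⟨d, hd⟩
    choose d hd using hd
    have hx := fun n => h2 (d n).1 (d n).2 _ (IsometricFlow.isMild_sol hP hb hbI _)
    choose u u' hu hu0 hu0' _ using hx
    refine ⟨u, u', hu, fun T => ?_⟩
    have hlim : Tendsto (fun n : ℕ => C * ‖x - toEnergy A (d n).1 (d n).2‖) atTop (𝓝 0) := by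
      have : Tendsto (fun n : ℕ => ‖x - toEnergy A (d n).1 (d n).2‖) atTop (𝓝 0) :=
        squeeze_zero (fun n => norm_nonneg _)
          (fun n => by rw [norm_sub_rev]; exact (hd n).le) tendsto_one_div_add_atTop_nhds_zero_nat
      simpa using this.const_mul C
    refine Metric.tendstoUniformlyOn_iff.2 fun ε hε => ?_
    filter_upwards [hlim.eventually (gt_mem_nhds hε)] with n hn t ht
    have hm := h1 _ _ (hu n)
    rw [hu0, hu0'] at hm
    rw [dist_eq_norm]
    exact (hC _ _ _ _ hU hm t ht.1).trans_lt hn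

theorem toEnergy_eq_iff {u v : (sqrtOp A).domain} {u' v' : H} :
    toEnergy A u u' = toEnergy A v v' ↔ sqrtOp A u = sqrtOp A v ∧ u' = v' := by
  obtain ⟨ι, hι⟩ := exists_energyEmbedding A
  rw [← ι.injective.eq_iff, hι, hι]
  refine ⟨fun h => ⟨congrArg WithLp.fst h, congrArg WithLp.snd h⟩, fun h => prod_ext h.1 h.2⟩

theorem wellPosed_of_isMild (hP : ‖P‖ ≤ 1) (hb : ∀ t, 0 ≤ t → 0 ≤ b t)
    (hbI : IntegrableOn b (Ici 0))
    (h1 : ∀ u u', IsFiniteEnergySolution A b u u' →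
      S.IsMild P b (toEnergy A (u 0) (u' 0)) (fun t => toEnergy A (u t) (u' t)))
    (h2 : ∀ u₁ u₂ U, S.IsMild P b (toEnergy A u₁ u₂) U →
      ∃ u u', IsFiniteEnergySolution A b u u' ∧ u 0 = u₁ ∧ u' 0 = u₂ ∧
        ∀ t ∈ Ici (0 : ℝ), U t = toEnergy A (u t) (u' t)) :
    WellPosed A b where
  exists_finite u₁ u₂ := by
    obtain ⟨u, u', h, h0, h0', -⟩ := h2 u₁ u₂ _ (IsometricFlow.isMild_sol hP hb hbI _)
    exact ⟨u, u', h, h0, h0'⟩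
  unique_finite u u' v v' hu hv h0 h0' := by
    have hm := h1 v v' hv
    rw [← h0, ← h0'] at hm
    have heq := (h1 u u' hu).eqOn hP hb hbI hm
    have h' : EqOn u' v' (Ici 0) := fun t ht => (toEnergy_eq_iff.1 (heq ht)).2
    -- Equality in `E` determines `u` only modulo `Ker Λ`; `u` itself is recovered from `u 0` and
    -- the integral of `u'`.
    refine ⟨fun t ht => Subtype.ext ?_, h'⟩
    rw [hu.eq_integral ht, hv.eq_integral ht, h0]
    congr 1
    refine intervalIntegral.integral_congr fun s hs => ?_
    rw [uIcc_of_le ht] at hs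
    exact h' hs.1
  exists_energy x := ⟨_, (isEnergySolution_iff hP hb hbI h1 h2).2
    (IsometricFlow.isMild_sol hP hb hbI x)⟩
  unique_energy x U V hU hV := by
    rw [isEnergySolution_iff hP hb hbI h1 h2] at hU hV
    exact hU.eqOn hP hb hbI hV

end EnergySolution
end DampedWave

theorem theorem1 {H : Type*} [NormedAddCommGroup H] [InnerProductSpace ℂ H] [CompleteSpace H]
    [TopologicalSpace.SeparableSpace H]
    (A : H →ₗ.[ℂ] H) (hA : IsSelfAdjoint A) (hA_nonneg : DampedWave.IsNonneg A)
    (b : ℝ → ℝ) (hb : ∀ t, 0 ≤ t → 0 ≤ b t) (hb_int : IntegrableOn b (Ici 0)) :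
    DampedWave.WellPosed A b ∧ DampedWave.WellPosed A 0 ∧
    ∃ (W : DampedWave.EnergySpace A ≃L[ℂ] DampedWave.EnergySpace A) (C : ℝ),
      ∀ (x : DampedWave.EnergySpace A) (U V : ℝ → DampedWave.EnergySpace A),
        DampedWave.IsEnergySolution A b x U → DampedWave.IsEnergySolution A 0 (W x) V →
          (∀ t, 0 ≤ t → ‖U t - V t‖ ≤ C * ‖x‖ * ∫ τ in Ioi t, b τ) ∧
          Tendsto (fun t => C * ‖x‖ * ∫ τ in Ioi t, b τ) atTop (𝓝 0) ∧
          Tendsto (fun t => ‖U t - V t‖) atTop (𝓝 0) ∧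
          (x ≠ 0 → ∃ l : ℝ, 0 < l ∧ Tendsto (fun t => ‖U t‖) atTop (𝓝 l)) := by
  obtain ⟨S, P, hP, h⟩ := DampedWave.exists_energyFlow hA hA_nonneg
  have hz : ∀ t : ℝ, 0 ≤ t → 0 ≤ (0 : ℝ → ℝ) t := fun _ _ => le_rfl
  have hz_int : IntegrableOn (0 : ℝ → ℝ) (Ici 0) := integrableOn_zero
  obtain ⟨h1, h2⟩ := h b hb_int
  obtain ⟨h3, h4⟩ := h 0 hz_int
  refine ⟨DampedWave.wellPosed_of_isMild hP hb hb_int h1 h2,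
    DampedWave.wellPosed_of_isMild hP hz hz_int h3 h4, ?_⟩
  obtain ⟨W, C, hW⟩ := DampedWave.IsometricFlow.exists_wave_operator (S := S) hP hb hb_int
  refine ⟨W, C, fun x U V hU hV => ?_⟩
  rw [DampedWave.isEnergySolution_iff hP hb hb_int h1 h2] at hU
  rw [DampedWave.isEnergySolution_iff hP hz hz_int h3 h4] at hV
  obtain ⟨hle, hnorm⟩ := hW x U V hU hV
  have hlim : Tendsto (fun t => C * ‖x‖ * ∫ τ in Ioi t, b τ) atTop (𝓝 0) := by
    simpa using (DampedWave.IsometricFlow.tendsto_setIntegral_Ioi hb_int).const_mul (C * ‖x‖)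
  have hdiff : Tendsto (fun t => ‖U t - V t‖) atTop (𝓝 0) := by
    refine squeeze_zero' (Eventually.of_forall fun t => norm_nonneg _) ?_ hlim
    filter_upwards [eventually_ge_atTop 0] with t ht using hle t ht
  -- The free solution has constant norm `‖W x‖`, which is therefore the limit; it is positive
  -- because `W` is injective.
  refine ⟨hle, hlim, hdiff, fun hx => ⟨‖W x‖, norm_pos_iff.2 ?_, ?_⟩⟩
  · exact fun h0 => hx (W.map_eq_zero_iff.1 h0)
  · rw [tendsto_iff_norm_sub_tendsto_zero]
    refine squeeze_zero' (Eventually.of_forall fun t => norm_nonneg _) ?_ hdiff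
    filter_upwards [eventually_ge_atTop 0] with t ht
    rw [← hnorm t ht]
    exact abs_norm_sub_norm_le _ _
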